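/- Let $k,n\ge 0$ be integers and let $K$ be a field of characteristic $0$. Edges are the two-element subsets of $[n]=\{1,\dots,n\}$. Two edges $\{i<j\}$ and $\{i'<j'\}$ cross if $i<i'<j<j'$ or $i'<i<j'<j$. A $(k+1)$-crossing is a set of $k+1$ mutually crossing edges, and a $k$-triangulation is an inclusion-maximal set of edges containing no $(k+1)$-crossing. For $U\subseteq[n]$ with $|U|=2k+2$, the Pfaffian of $U$ is $\sum_E (-1)^{\mathrm{cr}(E)}\prod_{e\in E}x_e$, where $E$ runs over the perfect matchings of $U$ and $\mathrm{cr}(E)$ is the number of crossing pairs of edges in $E$. Let $I_k(n)\subset K[x_{i,j}:\{i,j\}\in\binom{[n]}{2}]$ be the ideal generated by these Pfaffians of degree $k+1$, and let $\mathcal{P}f_k(n)\subset K^{\binom n2}$ be its zero set. The algebraic matroid of $\mathcal{P}f_k(n)$ has as elements the variables $x_{i,j}$ (identified with the edges), a set $S$ being independent iff $I_k(n)$ contains no non-zero polynomial in the variables of $S$ only. For a configuration $\mathbf p=(\mathbf p_1,\dots,\mathbf p_n)$ of points in $K^d$ or $\mathbb R^d$, the hyperconnectivity matrix $H(\mathbf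 p)$ has one row for each edge and $d$ columns for each vertex; the row of $\{i<j\}$ has $\mathbf p_j$ in the columns of $i$, $-\mathbf p_i$ in the columns of $j$, and $0$ elsewhere. For real $\mathbf p$, let $\mathcal H_d(\mathbf p)$ be the linear matroid of the rows of $H(\mathbf p)$. The generic hyperconnectivity matroid $\mathcal H_d$ is the freest of these: a set of edges is independent in $\mathcal H_d$ iff it is independent in $\mathcal H_d(\mathbf p)$ for some $\mathbf p\in(\mathbb R^d)^n$. Then: 1. There is an open dense set of configurations $\mathbf p\in(\mathbb R^{2k})^n$ for which $\mathcal H_{2k}(\mathbf p)=\mathcal H_{2k}$. 2. The image of the polynomial map $T:(K^n)^{2k}\to K^{\binom n2}$, $$T(\mathbf a_1,\mathbf b_1,\dots,\mathbf a_k,\mathbf b_k)=\Bigl(\sum_{l=1}^k (a_{l,i}b_{l,j}-a_{l,j}b_{l,i})\Bigr)_{1\le i<j\le n},$$ is exactly $\mathcal{P}f_k(n)$. 3. The Jacobian matrix of $T$ at every point $(\mathbf a_1,\mathbf b_1,\dots,\mathbf a_k,\mathbf b_k)$ equals the hyperconnectivity matrix of the configuration $\mathbf p_i=(b_{1,i},-a_{1,i},\dots,b_{k,i},-a_{k,i})$,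 $i=1,\dots,n$, where the columns of vertex $i$ correspond, in order, to the coordinates $a_{1,i},b_{1,i},\dots,a_{k,i},b_{k,i}$. 4. The algebraic matroid of $\mathcal{P}f_k(n)$ coincides with the generic hyperconnectivity matroid $\mathcal H_{2k}$ of dimension $2k$. 5. Consequently, every $k$-triangulation is a basis of $\mathcal H_{2k}$. -/

import Mathlib

/-! ### Edges, crossings and multitriangulations -/

/-- Edges of the complete graph on `[n]`: a two-element subset of `[n]` is written as a pair
`(i, j)` with `i < j`. -/
abbrev KEdge (n : ℕ) : Type := {e : Fin n × Fin n // e.1 < e.2}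

/-- `(i, j)` and `(i', j')` with `i < j`, `i' < j'` cross if `i < i' < j < j'` or
`i' < i < j' < j`. -/
def KEdge.Crosses {n : ℕ} (e f : KEdge n) : Prop :=
  (e.1.1 < f.1.1 ∧ f.1.1 < e.1.2 ∧ e.1.2 < f.1.2) ∨
    (f.1.1 < e.1.1 ∧ e.1.1 < f.1.2 ∧ f.1.2 < e.1.2)

/-- An `m`-crossing: a set of `m` edges that mutually cross each other. -/
def IsMCrossing {n : ℕ} (m : ℕ) (C : Finset (KEdge n)) : Prop :=
  C.card = m ∧ ∀ e ∈ C, ∀ f ∈ C, e ≠ f → e.Crosses f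

/-- A set of edges is `m`-free if it contains no `m`-crossing. -/
def IsCrossingFree {n : ℕ} (m : ℕ) (T : Set (KEdge n)) : Prop :=
  ∀ C : Finset (KEdge n), IsMCrossing m C → ¬ (C : Set (KEdge n)) ⊆ T

/-- A `k`-triangulation of the `n`-gon: an inclusion-maximal `(k+1)`-free set of edges. -/
def IsMultitriangulation {n : ℕ} (k : ℕ) (T : Set (KEdge n)) : Prop :=
  Maximal (IsCrossingFree (k + 1)) T

/-! ### Pfaffians and the ideal they generate -/

/-- `E` is a perfect matching of the vertex set `U ⊆ [n]`. -/
def IsPerfectMatchingOn {n : ℕ} (U : Finset (Fin n)) (E : Finset (KEdge n)) : Prop :=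
  (∀ e ∈ E, e.1.1 ∈ U ∧ e.1.2 ∈ U) ∧ ∀ v ∈ U, ∃! e : KEdge n, e ∈ E ∧ (e.1.1 = v ∨ e.1.2 = v)

open Classical in
/-- The number of (unordered) pairs of crossing edges in `E`; each such pair is counted once,
in the order in which the edge with the smaller first endpoint comes first. -/
noncomputable def crossingNumber {n : ℕ} (E : Finset (KEdge n)) : ℕ :=
  ((E ×ˢ E).filter fun ef =>
    ef.1.1.1 < ef.2.1.1 ∧ ef.2.1.1 < ef.1.1.2 ∧ ef.1.1.2 < ef.2.1.2).card

open Classical in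
/-- The Pfaffian of the principal submatrix with rows and columns `U` of the generic
antisymmetric `n × n` matrix, whose entries above the diagonal are the variables `x_{i,j}`. -/
noncomputable def pfaffianPoly {n : ℕ} (K : Type*) [CommRing K] (U : Finset (Fin n)) :
    MvPolynomial (KEdge n) K :=
  ∑ E ∈ Finset.univ.filter (IsPerfectMatchingOn U),
    (-1) ^ crossingNumber E * ∏ e ∈ E, MvPolynomial.X e

/-- The ideal `I_k(n)` generated by all Pfaffians of degree `k + 1`. -/
noncomputable def pfaffianIdeal (K : Type*) [CommRing K] (k n : ℕ) :
    Ideal (MvPolynomial (KEdge n) K) :=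
  Ideal.span {f | ∃ U : Finset (Fin n), U.card = 2 * (k + 1) ∧ f = pfaffianPoly K U}

/-! ### Algebraic matroids -/

/-- `M` is the algebraic matroid of the ideal `I ⊆ K[x_s : s ∈ σ]`: its elements are the variables
(all of `σ`), and `S` is independent iff `I` contains no non-zero polynomial in `K[S]`. -/
def IsAlgebraicMatroidOf {σ K : Type*} [Field K] (M : Matroid σ)
    (I : Ideal (MvPolynomial σ K)) : Prop :=
  M.E = Set.univ ∧
    ∀ S : Set σ, M.Indep S ↔ ∀ f ∈ I, f ∈ MvPolynomial.supported K S → f = 0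

/-! ### Linear matroids -/

theorem linearIndepOn_augment {ι K V : Type*} [Finite ι] [Field K] [AddCommGroup V] [Module K V]
    (v : ι → V) {I J : Set ι} (hI : LinearIndepOn K v I) (hJ : LinearIndepOn K v J)
    (hIJ : I.ncard < J.ncard) : ∃ e ∈ J, e ∉ I ∧ LinearIndepOn K v (insert e I) := by
  classical
  by_contra! h
  have hsub : ∀ e ∈ J, v e ∈ Submodule.span K (v '' I) := by
    intro e he
    by_cases heI : e ∈ I
    · exact Submodule.subset_span ⟨e, heI, rfl⟩
    · by_contra hn
      exact h e he heI ((linearIndepOn_insert heI).2 ⟨hI, hn⟩)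
  have := Fintype.ofFinite ι
  have hle : Submodule.span K (Set.range fun x : J => v x) ≤
      Submodule.span K (Set.range fun x : I => v x) := by
    rw [Submodule.span_le]
    rintro _ ⟨x, rfl⟩
    have := hsub x x.2
    rwa [Set.image_eq_range] at this
  have h1 := finrank_span_eq_card hJ
  have h2 := finrank_span_eq_card hI
  have : FiniteDimensional K (Submodule.span K (Set.range fun x : I => v x)) :=
    FiniteDimensional.span_of_finite K (Set.finite_range _)
  have h3 := Submodule.finrank_mono hle
  rw [h1, h2, ← Nat.card_eq_fintype_card, ← Nat.card_eq_fintype_card] at h3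
  exact absurd h3 (not_le.2 hIJ)

/-- The linear matroid of a finite family of vectors. -/
noncomputable def linearMatroid {ι : Type*} (K : Type*) {V : Type*} [Finite ι] [Field K]
    [AddCommGroup V] [Module K V] (v : ι → V) : Matroid ι :=
  (IndepMatroid.ofFinite (E := Set.univ) Set.finite_univ
    (fun S => LinearIndepOn K v S)
    (linearIndepOn_empty K v)
    (fun _ _ hJ hIJ => hJ.mono hIJ)
    (fun _ _ hI hJ hIJ => linearIndepOn_augment v hI hJ hIJ)
    (fun _ _ => Set.subset_univ _)).matroid

theorem linearMatroid_indep_iff {ι K V : Type*} [Finite ι] [Field K]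
    [AddCommGroup V] [Module K V] (v : ι → V) (S : Set ι) :
    (linearMatroid K v).Indep S ↔ LinearIndepOn K v S := Iff.rfl

/-! ### Hyperconnectivity -/

/-- The hyperconnectivity matrix of a configuration `p_1, …, p_n ∈ R^d`: the row of the edge
`{i, j}`, `i < j`, has `p_j` in the `d` columns of vertex `i`, `-p_i` in the `d` columns of
vertex `j`, and zeros elsewhere. -/
def hyperconnectivityMatrix {R : Type*} [Ring R] {d n : ℕ} (p : Fin n → Fin d → R) :
    Matrix (KEdge n) (Fin n × Fin d) R :=
  Matrix.of fun e mc =>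
    if mc.1 = e.1.1 then p e.1.2 mc.2 else if mc.1 = e.1.2 then -p e.1.1 mc.2 else 0

/-- The hyperconnectivity matroid `𝓗_d(p)` of a real configuration `p`: the linear matroid of the
rows of its hyperconnectivity matrix. -/
noncomputable def hyperconnectivityMatroid {d n : ℕ} (p : Fin n → Fin d → ℝ) :
    Matroid (KEdge n) :=
  linearMatroid ℝ (hyperconnectivityMatrix p).row

theorem linearIndependent_row_iff_gram_det_ne_zero {m N : Type*} [Fintype m] [DecidableEq m]
    [Fintype N] (A : Matrix m N ℝ) :
    LinearIndependent ℝ A.row ↔ (A * A.transpose).det ≠ 0 := by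
  rw [← isUnit_iff_ne_zero, ← Matrix.isUnit_iff_isUnit_det,
    ← Matrix.linearIndependent_rows_iff_isUnit, linearIndependent_iff_card_eq_finrank_span,
    linearIndependent_iff_card_eq_finrank_span, Set.finrank, Set.finrank,
    ← Matrix.rank_eq_finrank_span_row, ← Matrix.rank_eq_finrank_span_row,
    Matrix.rank_self_mul_transpose]

/-- Along the line `p + t (q - p)`, independence of a set of rows is the non-vanishing of a
polynomial in `t`. -/
theorem exists_polynomial_indep {d n : ℕ} (p q : Fin n → Fin d → ℝ) (S : Set (KEdge n)) :
    ∃ g : Polynomial ℝ, ∀ t : ℝ, g.eval t ≠ 0 ↔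
      LinearIndepOn ℝ (hyperconnectivityMatrix (p + t • (q - p))).row S := by
  classical
  let P : Fin n → Fin d → Polynomial ℝ := fun i c =>
    Polynomial.C (p i c) + Polynomial.X * Polynomial.C (q i c - p i c)
  let A : Matrix S (Fin n × Fin d) (Polynomial ℝ) :=
    (hyperconnectivityMatrix P).submatrix Subtype.val id
  refine ⟨(A * A.transpose).det, fun t => ?_⟩
  have hA : A.map (Polynomial.evalRingHom t) =
      (hyperconnectivityMatrix (p + t • (q - p))).submatrix Subtype.val id := by
    ext e mc
    simp only [A, P, hyperconnectivityMatrix, Matrix.map_apply, Matrix.submatrix_apply,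
      Matrix.of_apply, id]
    split_ifs <;> simp
  have h := linearIndependent_row_iff_gram_det_ne_zero (A.map (Polynomial.evalRingHom t))
  have h2 : ((A * A.transpose).det).eval t =
      (A.map (Polynomial.evalRingHom t) * (A.map (Polynomial.evalRingHom t)).transpose).det := by
    rw [← Matrix.transpose_map, ← Matrix.map_mul, ← Polynomial.coe_evalRingHom, RingHom.map_det]
    rfl
  rw [h2, ← h, hA]
  rfl

theorem exists_common_indep {d n : ℕ} {S T : Set (KEdge n)}
    (hS : ∃ p : Fin n → Fin d → ℝ, (hyperconnectivityMatroid p).Indep S)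
    (hT : ∃ p : Fin n → Fin d → ℝ, (hyperconnectivityMatroid p).Indep T) :
    ∃ p : Fin n → Fin d → ℝ,
      (hyperconnectivityMatroid p).Indep S ∧ (hyperconnectivityMatroid p).Indep T := by
  obtain ⟨p, hp⟩ := hS
  obtain ⟨q, hq⟩ := hT
  obtain ⟨f, hf⟩ := exists_polynomial_indep p q S
  obtain ⟨g, hg⟩ := exists_polynomial_indep p q T
  have hf0 : f ≠ 0 := by
    rintro rfl
    have : LinearIndepOn ℝ (hyperconnectivityMatrix (p + (0 : ℝ) • (q - p))).row S := by
      simpa using (linearMatroid_indep_iff _ _).1 hp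
    exact (hf 0).2 this (by simp)
  have hg0 : g ≠ 0 := by
    rintro rfl
    have : LinearIndepOn ℝ (hyperconnectivityMatrix (p + (1 : ℝ) • (q - p))).row T := by
      simpa using (linearMatroid_indep_iff _ _).1 hq
    exact (hg 1).2 this (by simp)
  obtain ⟨t, ht⟩ : ∃ t : ℝ, (f * g).eval t ≠ 0 := by
    by_contra! h
    exact mul_ne_zero hf0 hg0 (Polynomial.funext (by simpa using h))
  rw [Polynomial.eval_mul] at ht
  exact ⟨p + t • (q - p), (hf t).1 (left_ne_zero_of_mul ht), (hg t).1 (right_ne_zero_of_mul ht)⟩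

/-- The generic hyperconnectivity matroid `𝓗_d` on the edges of `K_n`, the freest of the matroids
`𝓗_d(p)`: a set of edges is independent iff it is independent in `𝓗_d(p)` for some configuration
`p` of `n` points in `ℝ^d` (equivalently, for all `p` in an open dense set). -/
noncomputable def genericHyperconnectivityMatroid (d n : ℕ) : Matroid (KEdge n) :=
  (IndepMatroid.ofFinite (E := Set.univ) Set.finite_univ
    (fun S => ∃ p : Fin n → Fin d → ℝ, (hyperconnectivityMatroid p).Indep S)
    ⟨0, Matroid.empty_indep _⟩
    (fun _ _ ⟨p, hJ⟩ hIJ => ⟨p, hJ.subset hIJ⟩)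
    (fun I J hI hJ hIJ => by
      obtain ⟨p, hpI, hpJ⟩ := exists_common_indep hI hJ
      obtain ⟨e, heJ, heI, he⟩ := linearIndepOn_augment _ hpI hpJ hIJ
      exact ⟨e, heJ, heI, p, he⟩)
    (fun _ _ => Set.subset_univ _)).matroid

/-! ### The parametrization by `k` pairs of vectors -/

/-- The coordinates of `(a_1, b_1, …, a_k, b_k) ∈ (K^n)^{2k}`: `a_{l,i}` has index `inl (l, i)` and
`b_{l,i}` has index `inr (l, i)`. -/
abbrev PairIndex (k n : ℕ) : Type := (Fin k × Fin n) ⊕ (Fin k × Fin n)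

/-- The `(i, j)` component, `i < j`, of the parametrization `T`, as a polynomial in the coordinates:
`∑_l (a_{l,i} b_{l,j} - a_{l,j} b_{l,i})`. -/
noncomputable def pairParamPoly (K : Type*) [CommRing K] (k n : ℕ) (e : KEdge n) :
    MvPolynomial (PairIndex k n) K :=
  ∑ l : Fin k,
    (MvPolynomial.X (Sum.inl (l, e.1.1)) * MvPolynomial.X (Sum.inr (l, e.1.2)) -
      MvPolynomial.X (Sum.inl (l, e.1.2)) * MvPolynomial.X (Sum.inr (l, e.1.1)))

/-- The polynomial map `T : (K^n)^{2k} → K^{n choose 2}`. -/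
noncomputable def pairParamMap (K : Type*) [CommRing K] (k n : ℕ) (x : PairIndex k n → K) :
    KEdge n → K :=
  fun e => MvPolynomial.eval x (pairParamPoly K k n e)

/-- The Jacobian matrix of `T` at the point `x`. -/
noncomputable def pairParamJacobian {K : Type*} [CommRing K] {k n : ℕ} (x : PairIndex k n → K) :
    Matrix (KEdge n) (PairIndex k n) K :=
  Matrix.of fun e s => MvPolynomial.eval x (MvPolynomial.pderiv s (pairParamPoly K k n e))

/-- The configuration `p_i = (b_{1,i}, -a_{1,i}, …, b_{k,i}, -a_{k,i})`. -/
def pairConfiguration {K : Type*} [CommRing K] {k n : ℕ} (x : PairIndex k n → K) :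
    Fin n → Fin (2 * k) → K :=
  fun i c =>
    if c.1 % 2 = 0 then x (Sum.inr (⟨c.1 / 2, by omega⟩, i))
    else -x (Sum.inl (⟨c.1 / 2, by omega⟩, i))

/-- The matching of the columns: among the `2k` columns of vertex `i`, the ones numbered
`0, 1, 2, 3, …` correspond to the coordinates `a_{1,i}, b_{1,i}, a_{2,i}, b_{2,i}, …`. -/
def pairColumns (k n : ℕ) : PairIndex k n ≃ Fin n × Fin (2 * k) where
  toFun
    | Sum.inl (l, i) => (i, ⟨2 * l.1, by omega⟩)
    | Sum.inr (l, i) => (i, ⟨2 * l.1 + 1, by omega⟩)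
  invFun ic :=
    if ic.2.1 % 2 = 0 then Sum.inl (⟨ic.2.1 / 2, by omega⟩, ic.1)
    else Sum.inr (⟨ic.2.1 / 2, by omega⟩, ic.1)
  left_inv := by
    rintro (⟨l, i⟩ | ⟨l, i⟩)
    · simp
    · have h : (2 * l.1 + 1) / 2 = l.1 := by omega
      simp [Nat.add_mod, h]
  right_inv := by
    rintro ⟨i, c, hc⟩
    dsimp only
    split_ifs with h
    · simp only [Prod.mk.injEq, Fin.mk.injEq, true_and]; omega
    · simp only [Prod.mk.injEq, Fin.mk.injEq, true_and]; omega

/-! A point x of K^(n choose 2) is a bivector ω = ∑ x_{ij} e_i ∧ e_j, and ω^m = m! ∑ Pf_U(x) e_U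
over |U| = 2m (`bivector_pow`). In characteristic 0 the Pfaffians of degree k+1 thus vanish at x iff
ω^(k+1) = 0, iff ω is a sum of k products a_l ∧ b_l, iff x lies in the image of T
(`range_pairParamMap`). Over the algebraic closure the Nullstellensatz then identifies the radical
of I_k(n) with the kernel of x_e ↦ T_e, so the algebraic matroid records algebraic independence of
the polynomials T_e. By the Jacobian criterion this means that some minor of the Jacobian is a
nonzero polynomial. The minors have integer coefficients, so K may be replaced by ℝ, where the
Jacobians of T are exactly the hyperconnectivity matrices.

A k-triangulation is a basis because it is independent and large enough. Independence
(`algebraicIndepOn_pairParamPoly_of_isCrossingFree`): a weight degeneration replaces a_i·b_j -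
a_j·b_i by a_i·b_j, so it suffices to find vectors in F^k whose products a_i·b_j are generic on T.
They come from a matrix completion (`exists_completion`): generic entries on T extend to a matrix
each of whose upper right blocks has rank at most the length of the longest chain of T in it. Chains
in blocks above the diagonal are crossings, so these blocks have rank at most k, and factoring them
gives a and b.

Size: `IsMultitriangulation.card_le` shows that at most C(n-2k, 2) edges are missing, by an
induction over cells in which every missing cell uses up an ascent of a sequence. Conversely, the
antisymmetric matrices XᵀSX with XP = 0 give at least C(n-2k, 2) dimensions of linear relations
between the rows of H(p), so no independent set is larger
(`ncard_add_card_kEdge_le_of_linearIndepOn`). -/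

/-! ### Algebraic independence and specialization of a new variable to 0 -/

open Polynomial in
-- Evaluation at 0 kills the constant coefficient of a relation for `X`; the relation is then
-- divisible by `X`, and its degree drops.
theorem transcendental_X_of_eval_zero {K F : Type*} [Field K] [Field F] [Algebra K F]
    (A : Subalgebra K F[X]) (hA : ∀ a ∈ A, a.eval 0 = 0 → a = 0) :
    Transcendental A (X : F[X]) := by
  rw [transcendental_iff]
  suffices h : ∀ d : ℕ, ∀ p : A[X], p.natDegree ≤ d → aeval (X : F[X]) p = 0 → p = 0 from
    fun p hp => h _ p le_rfl hp
  intro d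
  induction d with
  | zero =>
    intro p hd hp
    rw [eq_C_of_natDegree_le_zero hd, aeval_C] at hp
    rw [eq_C_of_natDegree_le_zero hd]
    have : p.coeff 0 = 0 := Subtype.ext hp
    rw [this, C_0]
  | succ d ih =>
    intro p hd hp
    have hdec := p.divX_mul_X_add
    have h0 : p.coeff 0 = 0 := by
      apply Subtype.ext
      apply hA _ (p.coeff 0).2
      have h1 := congrArg (eval 0) hp
      rw [← hdec] at h1
      simp only [map_add, map_mul, aeval_X, aeval_C, eval_add, eval_mul, eval_X, mul_zero, zero_add,
        eval_zero] at h1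
      simpa using h1
    rw [h0, C_0, add_zero] at hdec
    have h2 : p.divX = 0 := by
      apply ih _ (by rw [natDegree_divX_eq_natDegree_tsub_one]; omega)
      rw [← hdec, map_mul, aeval_X] at hp
      exact (mul_eq_zero.1 hp).resolve_right X_ne_zero
    rw [← hdec, h2, zero_mul]

open Polynomial in
-- Independence of the values at 0 makes evaluation at 0 injective on K[f], as
-- `transcendental_X_of_eval_zero` requires.
theorem algebraicIndependent_option_X {ι K F : Type*} [Field K] [Field F] [Algebra K F]
    (f : ι → F[X]) (hf : AlgebraicIndependent K fun c => (f c).eval 0) :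
    AlgebraicIndependent K fun o : Option ι => o.elim X f := by
  let ev : F[X] →ₐ[K] F := (aeval (R := F) (0 : F)).restrictScalars K
  have hev : ∀ a, ev a = a.eval 0 := fun a => by
    simp [ev, Polynomial.coe_aeval_eq_eval]
  have hf' : AlgebraicIndependent K (ev ∘ f) := by
    convert! hf using 2
  have h1 : AlgebraicIndependent K f := hf'.of_comp ev
  refine (h1.option_iff_transcendental X).2 (transcendental_X_of_eval_zero _ ?_)
  intro a ha h0
  rw [Algebra.adjoin_range_eq_range_aeval] at ha
  obtain ⟨P, rfl⟩ := ha
  have : MvPolynomial.aeval (ev ∘ f) P = 0 := by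
    rw [← hev] at h0
    rw [← h0]
    exact (MvPolynomial.comp_aeval_apply f ev P).symm
  rw [hf'.eq_zero_of_aeval_eq_zero P this]
  simp

open Polynomial in
/-- Perturbing an algebraically independent family by multiples of a new variable, and adding the
inverse of that variable, preserves algebraic independence. -/
theorem algebraicIndepOn_insert_inv_X {ι K F L : Type*} [Field K] [Field F] [Algebra K F]
    [Field L] [Algebra F[X] L] [Algebra K L] [IsScalarTower K F[X] L]
    (hinj : Function.Injective (algebraMap F[X] L))
    {s : Set ι} {e : ι} (he : e ∉ s) (x : ι → L) (f : ι → F[X])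
    (hf : AlgebraicIndepOn K (fun c => (f c).eval 0) s)
    (hx : ∀ c ∈ s, x c = algebraMap F[X] L (f c)) (hxe : x e = (algebraMap F[X] L X)⁻¹) :
    AlgebraicIndepOn K x (insert e s) := by
  have h1 := algebraicIndependent_option_X (fun c : s => f c) hf
  have h2 := h1.map' (f := IsScalarTower.toAlgHom K F[X] L) hinj
  have h3 : AlgebraicIndependent K
      (fun o : Option s => o.elim (algebraMap F[X] L X) fun c => x c) := by
    convert! h2 using 2 with o
    cases o with
    | none => simp
    | some c => simp [hx c c.2]
  rw [AlgebraicIndependent.option_iff] at h3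
  obtain ⟨h4, h5⟩ := h3
  rw [AlgebraicIndepOn.insert_iff he]
  refine ⟨h4, ?_⟩
  rw [hxe]
  intro h
  apply h5
  have h6 := h.inv
  rw [inv_inv] at h6
  rwa [Set.image_eq_range] at h6

/-! ### Chains of cells and ranks of upper right blocks -/

/-- `T` contains a strictly increasing chain of `m` cells in the columns `≥ q`, rows `< p` and
columns `< n`. -/
def HasChain (T : Set (ℕ × ℕ)) (q : ℕ) : ℕ → ℕ → ℕ → Prop
  | 0, _, _ => True
  | m + 1, p, n => ∃ i < p, ∃ j < n, q ≤ j ∧ (i, j) ∈ T ∧ HasChain T q m i j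

theorem HasChain.mono {T T' : Set (ℕ × ℕ)} {q m p n p' n' : ℕ} (h : HasChain T q m p n)
    (hT : T ⊆ T') (hp : p ≤ p') (hn : n ≤ n') : HasChain T' q m p' n' := by
  induction m generalizing p n p' n' with
  | zero => trivial
  | succ m ih =>
    obtain ⟨i, hi, j, hj, hq, hm, hc⟩ := h
    exact ⟨i, by omega, j, by omega, hq, hT hm, ih hc le_rfl le_rfl⟩

section Blocks

variable {F : Type*} [Field F]

/-- Replace the entries outside the columns `q ≤ j < n` by zero. -/
def truncRow (q n : ℕ) : (ℕ → F) →ₗ[F] (ℕ → F) where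
  toFun v j := if q ≤ j ∧ j < n then v j else 0
  map_add' v w := by ext j; simp only [Pi.add_apply]; split_ifs <;> simp
  map_smul' c v := by ext j; simp

theorem truncRow_apply (q n : ℕ) (v : ℕ → F) (j : ℕ) :
    truncRow q n v j = if q ≤ j ∧ j < n then v j else 0 := rfl

/-- The row space of the block of rows `< p` and columns in `[q, n)`. -/
def blockSpan (M : ℕ → ℕ → F) (p q n : ℕ) : Submodule F (ℕ → F) :=
  Submodule.span F ((fun i => truncRow q n (M i)) '' Set.Iio p)

/-- The rank of the block of rows `< p` and columns in `[q, n)`. -/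
noncomputable def blockRank (M : ℕ → ℕ → F) (p q n : ℕ) : ℕ :=
  Module.finrank F (blockSpan M p q n)

instance (M : ℕ → ℕ → F) (p q n : ℕ) : FiniteDimensional F (blockSpan M p q n) :=
  FiniteDimensional.span_of_finite _ ((Set.finite_Iio p).image _)

theorem truncRow_mem_blockSpan (M : ℕ → ℕ → F) {i p : ℕ} (q n : ℕ) (h : i < p) :
    truncRow q n (M i) ∈ blockSpan M p q n :=
  Submodule.subset_span ⟨i, h, rfl⟩

theorem blockSpan_le {M : ℕ → ℕ → F} {p q n : ℕ} {S : Submodule F (ℕ → F)} :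
    blockSpan M p q n ≤ S ↔ ∀ i < p, truncRow q n (M i) ∈ S := by
  rw [blockSpan, Submodule.span_le]
  constructor
  · exact fun h i hi => h ⟨i, hi, rfl⟩
  · rintro h _ ⟨i, hi, rfl⟩
    exact h i hi

theorem blockSpan_succ (M : ℕ → ℕ → F) (p q n : ℕ) :
    blockSpan M (p + 1) q n = blockSpan M p q n ⊔ Submodule.span F {truncRow q n (M p)} := by
  have : Set.Iio (p + 1) = insert p (Set.Iio p) := by ext x; simp
  rw [blockSpan, this, Set.image_insert_eq, Submodule.span_insert, sup_comm, blockSpan]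

theorem blockSpan_congr {M M' : ℕ → ℕ → F} {p q n : ℕ}
    (h : ∀ i < p, ∀ j, q ≤ j → j < n → M i j = M' i j) : blockSpan M p q n = blockSpan M' p q n := by
  have : Set.EqOn (fun i => truncRow q n (M i)) (fun i => truncRow q n (M' i)) (Set.Iio p) := by
    intro i hi
    ext j
    simp only [truncRow_apply]
    split_ifs with hj
    · exact h i hi j hj.1 hj.2
    · rfl
  rw [blockSpan, blockSpan, Set.image_congr this]

theorem blockRank_congr {M M' : ℕ → ℕ → F} {p q n : ℕ}
    (h : ∀ i < p, ∀ j, q ≤ j → j < n → M i j = M' i j) : blockRank M p q n = blockRank M' p q n := by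
  rw [blockRank, blockSpan_congr h, blockRank]

theorem blockRank_eq_zero_of_le (M : ℕ → ℕ → F) {p q n : ℕ} (h : n ≤ q) : blockRank M p q n = 0 := by
  have : blockSpan M p q n = ⊥ := by
    rw [eq_bot_iff, blockSpan_le]
    intro i _
    rw [Submodule.mem_bot]
    ext j
    rw [truncRow_apply, if_neg (by omega), Pi.zero_apply]
  rw [blockRank, this, finrank_bot]

theorem finrank_sup_span_singleton_le (S : Submodule F (ℕ → F)) [FiniteDimensional F S]
    (v : ℕ → F) : Module.finrank F (S ⊔ Submodule.span F {v} : Submodule F (ℕ → F)) ≤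
      Module.finrank F S + 1 :=
  (Submodule.finrank_add_le_finrank_add_finrank _ _).trans
    (by gcongr; exact (finrank_span_le_card {v}).trans (by simp))

theorem finrank_sup_span_singleton (S : Submodule F (ℕ → F)) [FiniteDimensional F S]
    {v : ℕ → F} (hv : v ∉ S) :
    Module.finrank F (S ⊔ Submodule.span F {v} : Submodule F (ℕ → F)) = Module.finrank F S + 1 := by
  refine le_antisymm (finrank_sup_span_singleton_le S v) ?_
  refine Nat.succ_le_of_lt (Submodule.finrank_lt_finrank_of_lt ?_)
  refine lt_of_le_of_ne le_sup_left fun h => hv ?_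
  rw [h]
  exact Submodule.mem_sup_right (Submodule.mem_span_singleton_self v)

theorem blockRank_map_le {L : Type*} [Field L] (σ : F →+* L) (M : ℕ → ℕ → F) (p q n : ℕ) :
    blockRank (fun i j => σ (M i j)) p q n ≤ blockRank M p q n := by
  let b := Module.finBasis F (blockSpan M p q n)
  have hle : blockSpan (fun i j => σ (M i j)) p q n ≤
      Submodule.span L (Set.range fun t => fun j => σ ((b t : ℕ → F) j)) := by
    rw [blockSpan_le]
    intro i hi
    have h1 := b.sum_repr ⟨_, truncRow_mem_blockSpan M q n hi⟩
    have h2 : truncRow q n (fun j => σ (M i j)) =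
        ∑ t, σ (b.repr ⟨_, truncRow_mem_blockSpan M q n hi⟩ t) •
          fun j => σ ((b t : ℕ → F) j) := by
      have h3 := congrArg (Submodule.subtype _) h1
      rw [map_sum] at h3
      ext j
      have h4 := congrArg σ (congrFun h3 j)
      simp only [Finset.sum_apply, map_smul, Submodule.subtype_apply, Pi.smul_apply, smul_eq_mul,
        map_sum, map_mul, truncRow_apply] at h4
      simp only [Finset.sum_apply, Pi.smul_apply, smul_eq_mul, truncRow_apply]
      rw [h4]
      split_ifs <;> simp
    rw [h2]
    exact Submodule.sum_mem _ fun t _ => Submodule.smul_mem _ _ (Submodule.subset_span ⟨t, rfl⟩)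
  have : FiniteDimensional L
      (Submodule.span L (Set.range fun t => fun j => σ ((b t : ℕ → F) j))) :=
    FiniteDimensional.span_of_finite _ (Set.finite_range _)
  refine (Submodule.finrank_mono hle).trans ((finrank_range_le_card _).trans ?_)
  simp [blockRank]

/-- The matrix obtained from `M` by putting the large entry `y⁻¹` at `(i, n)` and undoing, on the
rows above, the elimination of column `n` with this pivot. -/
def pivotUpdate (M : ℕ → ℕ → F) (i n : ℕ) (y : F) (a j : ℕ) : F :=
  if a < i ∧ j < n then M a j + y * M a n * M i j
  else if a = i ∧ j = n then y⁻¹ else M a j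

theorem truncRow_pivotUpdate (M : ℕ → ℕ → F) {i n q a : ℕ} (y : F) (ha : a < i) :
    truncRow q (n + 1) (pivotUpdate M i n y a) =
      truncRow q (n + 1) (M a) + (y * M a n) • truncRow q n (M i) := by
  ext j
  simp only [truncRow_apply, pivotUpdate, Pi.add_apply, Pi.smul_apply, smul_eq_mul]
  by_cases hj : j < n
  · simp only [ha, hj, and_self, if_true, Nat.lt_succ_of_lt hj, and_true]
    split_ifs <;> ring
  · simp [hj, ha.ne]

/-- Adding to the columns in `[q, n)` multiples of column `n`. -/
def columnOperation (q n : ℕ) (y : F) (w : ℕ → F) : (ℕ → F) →ₗ[F] (ℕ → F) :=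
  LinearMap.id + (LinearMap.proj (R := F) (φ := fun _ => F) n).smulRight (y • truncRow q n w)

theorem columnOperation_apply (q n : ℕ) (y : F) (w v : ℕ → F) :
    columnOperation q n y w v = v + v n • (y • truncRow q n w) := rfl

theorem columnOperation_truncRow (M : ℕ → ℕ → F) {i n q a : ℕ} (y : F) (hq : q ≤ n) (ha : a < i) :
    columnOperation q n y (M i) (truncRow q (n + 1) (M a)) =
      truncRow q (n + 1) (pivotUpdate M i n y a) := by
  rw [truncRow_pivotUpdate M y ha, columnOperation_apply, truncRow_apply, if_pos (by omega),
    smul_smul, mul_comm]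

/-- On rows above the pivot the update is a column operation. -/
theorem blockRank_pivotUpdate_of_le (M : ℕ → ℕ → F) {i n q p : ℕ} (y : F) (hq : q ≤ n)
    (hp : p ≤ i) : blockRank (pivotUpdate M i n y) p q (n + 1) ≤ blockRank M p q (n + 1) := by
  have : blockSpan (pivotUpdate M i n y) p q (n + 1) ≤
      (blockSpan M p q (n + 1)).map (columnOperation q n y (M i)) := by
    rw [blockSpan_le]
    intro a ha
    exact ⟨_, truncRow_mem_blockSpan M q (n + 1) ha,
      columnOperation_truncRow M y hq (by omega)⟩
  exact (Submodule.finrank_mono this).trans (Submodule.finrank_map_le _ _)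

/-- The pivot row is the image of y⁻¹ e_n under the same column operation, so the original row `i`
may be replaced by e_n. -/
theorem blockRank_pivotUpdate_succ (M : ℕ → ℕ → F) {i n q : ℕ} {y : F} (hy : y ≠ 0) (hq : q ≤ n) :
    blockRank (pivotUpdate M i n y) (i + 1) q (n + 1) ≤
      blockRank (Function.update M i (Pi.single n 1)) (i + 1) q (n + 1) := by
  have : blockSpan (pivotUpdate M i n y) (i + 1) q (n + 1) ≤
      (blockSpan (Function.update M i (Pi.single n 1)) (i + 1) q (n + 1)).map
        (columnOperation q n y (M i)) := by
    rw [blockSpan_le]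
    intro a ha
    rcases Nat.lt_succ_iff_lt_or_eq.1 ha with ha | rfl
    · refine ⟨_, truncRow_mem_blockSpan _ q (n + 1) (Nat.lt_succ_of_lt ha), ?_⟩
      rw [Function.update_of_ne ha.ne]
      exact columnOperation_truncRow M y hq ha
    · refine ⟨y⁻¹ • truncRow q (n + 1) (Pi.single n 1), Submodule.smul_mem _ _ ?_, ?_⟩
      · have := truncRow_mem_blockSpan (Function.update M a (Pi.single n (1 : F))) q (n + 1)
          (Nat.lt_succ_self a)
        rwa [Function.update_self] at this
      · ext j
        rw [columnOperation_apply]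
        simp only [truncRow_apply, pivotUpdate, Pi.add_apply, Pi.smul_apply, smul_eq_mul,
          lt_irrefl, false_and, if_false, true_and]
        rcases lt_trichotomy j n with hj | rfl | hj
        · simp [hj, hj.ne, Nat.lt_succ_of_lt hj, hq, hy]
        · simp [hq]
        · simp [hj.not_gt, show ¬ j < n + 1 by omega]
  exact (Submodule.finrank_mono this).trans (Submodule.finrank_map_le _ _)

/-- Before column `n` the update only adds multiples of row `i` to the rows above it, and row `i`
belongs to the block. -/
theorem blockRank_pivotUpdate_of_lt (M : ℕ → ℕ → F) {i n p : ℕ} (q : ℕ) (y : F)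
    (hp : i < p) : blockRank (pivotUpdate M i n y) p q n ≤ blockRank M p q n := by
  refine Submodule.finrank_mono (blockSpan_le.2 fun a ha => ?_)
  by_cases hai : a < i
  · have : truncRow q n (pivotUpdate M i n y a) =
        truncRow q n (M a) + (y * M a n) • truncRow q n (M i) := by
      ext j
      simp only [truncRow_apply, pivotUpdate, Pi.add_apply, Pi.smul_apply, smul_eq_mul]
      by_cases hj : j < n
      · simp only [hai, hj, and_self, if_true, and_true]
        split_ifs <;> ring
      · simp [hj]
    rw [this]
    exact Submodule.add_mem _ (truncRow_mem_blockSpan M q n ha)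
      (Submodule.smul_mem _ _ (truncRow_mem_blockSpan M q n hp))
  · have : truncRow q n (pivotUpdate M i n y a) = truncRow q n (M a) := by
      ext j
      simp only [truncRow_apply, pivotUpdate, hai, false_and, if_false]
      split_ifs <;> first | rfl | omega
    rw [this]
    exact truncRow_mem_blockSpan M q n ha

end Blocks

section ColumnStep

variable {F : Type*} [Field F]

theorem truncRow_succ (q n : ℕ) (hq : q ≤ n) (v : ℕ → F) :
    truncRow q (n + 1) v = truncRow q n v + v n • Pi.single n 1 := by
  ext j
  simp only [truncRow_apply, Pi.add_apply, Pi.smul_apply, smul_eq_mul]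
  rcases lt_trichotomy j n with hj | rfl | hj
  · simp [hj, hj.ne, Nat.lt_succ_of_lt hj]
  · simp [hq]
  · simp [hj.not_gt, hj.ne', show ¬ j < n + 1 by omega]

theorem truncRow_truncRow {q q' n n' : ℕ} (hq : q ≤ q') (hn : n ≤ n') (v : ℕ → F) :
    truncRow q' n' (truncRow q n v) = truncRow q' n v := by
  ext j
  simp only [truncRow_apply]
  split_ifs <;> first | rfl | omega

theorem truncRow_single {q n : ℕ} (hq : q ≤ n) :
    truncRow q (n + 1) (Pi.single n (1 : F)) = Pi.single n 1 := by
  ext j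
  rw [truncRow_apply]
  split_ifs with h
  · rfl
  · rw [Pi.single_eq_of_ne (by omega)]

theorem truncRow_mem_blockSpan_of_le (M : ℕ → ℕ → F) {p q q' n : ℕ} (hq : q ≤ q') {v : ℕ → F}
    (hv : v ∈ blockSpan M p q n) : truncRow q' n v ∈ blockSpan M p q' n := by
  have : blockSpan M p q n ≤ (blockSpan M p q' n).comap (truncRow q' n) := by
    rw [blockSpan_le]
    intro i hi
    rw [Submodule.mem_comap, truncRow_truncRow hq le_rfl]
    exact truncRow_mem_blockSpan M q' n hi
  exact this hv

theorem blockSpan_sup_single (M : ℕ → ℕ → F) (p : ℕ) {q n : ℕ} (hq : q ≤ n) :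
    blockSpan M p q (n + 1) ⊔ Submodule.span F {Pi.single n 1} =
      blockSpan M p q n ⊔ Submodule.span F {Pi.single n 1} := by
  have hs : (Pi.single n 1 : ℕ → F) ∈ Submodule.span F {(Pi.single n 1 : ℕ → F)} :=
    Submodule.mem_span_singleton_self _
  apply le_antisymm
  · refine sup_le (blockSpan_le.2 fun i hi => ?_) le_sup_right
    rw [truncRow_succ q n hq]
    exact Submodule.add_mem _ (Submodule.mem_sup_left (truncRow_mem_blockSpan M q n hi))
      (Submodule.mem_sup_right (Submodule.smul_mem _ _ hs))
  · refine sup_le (blockSpan_le.2 fun i hi => ?_) le_sup_right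
    rw [← add_sub_cancel_right (truncRow q n (M i)) (M i n • Pi.single n 1),
      ← truncRow_succ q n hq]
    exact Submodule.sub_mem _ (Submodule.mem_sup_left (truncRow_mem_blockSpan M q (n + 1) hi))
      (Submodule.mem_sup_right (Submodule.smul_mem _ _ hs))

/-- The rank of every block of rows `< p` and columns in `[q, n)` is at most the length of the
longest chain that `T` has in it. -/
def BlockRankLE (T : Set (ℕ × ℕ)) (M : ℕ → ℕ → F) (p n : ℕ) : Prop :=
  ∀ q r, ¬ HasChain T q (r + 1) p n → blockRank M p q n ≤ r

theorem blockSpan_update_succ (M : ℕ → ℕ → F) (i : ℕ) (v : ℕ → F) (q n : ℕ) :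
    blockSpan (Function.update M i v) (i + 1) q n =
      blockSpan M i q n ⊔ Submodule.span F {truncRow q n v} := by
  rw [blockSpan_succ, Function.update_self]
  congr 1
  exact blockSpan_congr fun a ha j _ _ => by rw [Function.update_of_ne ha.ne]

/-- When no entry at `(i, n)` lowers the rank of a block, the ranks for a large entry obey the
bounds already. -/
theorem finrank_sup_single_le_of_forall {T : Set (ℕ × ℕ)} {M : ℕ → ℕ → F} {i n q : ℕ} (hq : q ≤ n)
    (h1 : BlockRankLE T M i (n + 1)) (h2 : BlockRankLE T M (i + 1) n)
    (h : (Pi.single n 1 : ℕ → F) ∈ blockSpan M i q (n + 1) ∨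
      truncRow q n (M i) ∉ blockSpan M i q (n + 1) ⊔ Submodule.span F {Pi.single n 1})
    {r : ℕ} (hr : ¬ HasChain T q (r + 1) (i + 1) (n + 1)) :
    Module.finrank F (blockSpan M i q (n + 1) ⊔ Submodule.span F {Pi.single n 1} :
      Submodule F (ℕ → F)) ≤ r := by
  rcases h with h | h
  · rw [sup_eq_left.2 ((Submodule.span_singleton_le_iff_mem _ _).2 h)]
    exact h1 q r fun hc => hr (hc.mono subset_rfl (Nat.le_succ i) le_rfl)
  -- Row `i` already raises the rank in the columns before `n`, which makes up for the dimension
  -- that e_n may add.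
  · rw [blockSpan_sup_single M i hq] at h ⊢
    refine (finrank_sup_span_singleton_le _ _).trans ?_
    rw [← finrank_sup_span_singleton _ (fun hc => h (Submodule.mem_sup_left hc)),
      ← blockSpan_succ]
    exact h2 q r fun hc => hr (hc.mono subset_rfl le_rfl (Nat.le_succ n))

/-- When some entry at `(i, n)` lowers the rank of a block, it can be chosen such that all blocks
obey the bounds. -/
theorem exists_entry_blockRankLE {T : Set (ℕ × ℕ)} {M : ℕ → ℕ → F} {i n : ℕ}
    (h1 : BlockRankLE T M i (n + 1)) (h2 : BlockRankLE T M (i + 1) n)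
    (h : ∃ q, q ≤ n ∧ (Pi.single n 1 : ℕ → F) ∉ blockSpan M i q (n + 1) ∧
      truncRow q n (M i) ∈ blockSpan M i q (n + 1) ⊔ Submodule.span F {Pi.single n 1}) :
    ∃ u : F, BlockRankLE T (Function.update M i (Function.update (M i) n u)) (i + 1) (n + 1) := by
  classical
  -- The entry is chosen for the least such q₀. It puts row `i` into the span of the rows above on
  -- the columns from q₀ on, hence by truncation on those from any q ≥ q₀.
  obtain ⟨hqn, hz, hmem⟩ := Nat.find_spec h
  have hmin := fun q hq => Nat.find_min h (m := q) hq
  set q₀ := Nat.find h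
  obtain ⟨v, hv, w, hw, hvw⟩ := Submodule.mem_sup.1 hmem
  obtain ⟨c, rfl⟩ := Submodule.mem_span_singleton.1 hw
  have hrow : ∀ q ≤ n, truncRow q (n + 1) (Function.update (M i) n (-c)) =
      truncRow q n (M i) - c • Pi.single n 1 := by
    intro q hq
    rw [truncRow_succ q n hq, Function.update_self, neg_smul, ← sub_eq_add_neg]
    congr 1
    ext j
    simp only [truncRow_apply]
    split_ifs with hj
    · rw [Function.update_of_ne (by omega)]
    · rfl
  refine ⟨-c, fun q r hr => ?_⟩
  rcases Nat.lt_or_ge n q with hq | hq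
  · rw [blockRank_eq_zero_of_le _ hq]; exact Nat.zero_le _
  rw [blockRank, blockSpan_update_succ, hrow q hq]
  have hP : Module.finrank F (blockSpan M i q (n + 1)) ≤ r :=
    h1 q r fun hc => hr (hc.mono subset_rfl (Nat.le_succ i) le_rfl)
  rcases Nat.lt_or_ge q q₀ with hqq | hqq
  · refine (finrank_sup_span_singleton_le _ _).trans ?_
    have hz' : (Pi.single n 1 : ℕ → F) ∉ blockSpan M i q (n + 1) := fun hc => hz (by
      have := truncRow_mem_blockSpan_of_le M hqq.le hc
      rwa [truncRow_single hqn] at this)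
    have hm := hmin q hqq
    push Not at hm
    have hρ := hm hq hz'
    rw [blockSpan_sup_single M i hq] at hρ
    -- For q < q₀, `h3` and `h4` show that column `n` does not raise the rank of the rows above `i`,
    -- and `h5` that row `i` raises the rank even without column `n`. So the bound `h6` for the
    -- narrower block suffices.
    have h3 := finrank_sup_span_singleton _ hz'
    rw [blockSpan_sup_single M i hq] at h3
    have h4 := finrank_sup_span_singleton_le (blockSpan M i q n) (Pi.single n (1 : F))
    have h5 := finrank_sup_span_singleton _ (fun hc => hρ (Submodule.mem_sup_left hc))
    rw [← blockSpan_succ] at h5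
    have h6 := h2 q r fun hc => hr (hc.mono subset_rfl le_rfl (Nat.le_succ n))
    rw [blockRank] at h6
    omega
  · have : truncRow q n (M i) - c • Pi.single n 1 ∈ blockSpan M i q (n + 1) := by
      have h3 := truncRow_mem_blockSpan_of_le M hqq hv
      rw [eq_sub_of_add_eq hvw, map_sub, map_smul, truncRow_single hq,
        truncRow_truncRow hqq (Nat.le_succ n)] at h3
      exact h3
    rw [sup_eq_left.2 ((Submodule.span_singleton_le_iff_mem _ _).2 this)]
    exact hP

end ColumnStep

/-! ### Matrix completion, cell by cell -/

theorem algebraicIndepOn_congr {ι K A : Type*} [CommRing K] [CommRing A] [Algebra K A]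
    {x y : ι → A} {s : Set ι} (h : ∀ e ∈ s, x e = y e) (hx : AlgebraicIndepOn K x s) :
    AlgebraicIndepOn K y s := by
  have hxy : (fun e : s => x e) = fun e : s => y e := funext fun e => h e e.2
  have hx' : AlgebraicIndependent K fun e : s => x e := hx
  rw [hxy] at hx'
  exact hx'

universe u

/-- There is a matrix over an extension field of `K` whose entries at the cells of `T` in rows
`< m`, columns `< n` and in the first `i` rows of column `n` are algebraically independent, while
the ranks of its upper right blocks are at most the lengths of the chains of `T` in them. -/
def HasPartialCompletion (K : Type u) [Field K] (T : Set (ℕ × ℕ)) (m n i : ℕ) : Prop :=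
  ∃ (F : Type u) (_ : Field F) (_ : Algebra K F) (M : ℕ → ℕ → F),
    AlgebraicIndepOn K (fun e : ℕ × ℕ => M e.1 e.2)
      {e | e ∈ T ∧ e.1 < m ∧ (e.2 < n ∨ e.2 = n ∧ e.1 < i)} ∧
    -- Blocks with at most `i` rows already include column `n`; those with at least `i` rows stop
    -- before it.
    (∀ p ≤ i, BlockRankLE T M p (n + 1)) ∧ ∀ p, i ≤ p → p ≤ m → BlockRankLE T M p n

open Polynomial in
-- The entry at `(i, n)` becomes y⁻¹ for a new variable y. The other prescribed entries specialize
-- to their old values at y = 0, so independence survives. The cell `(i, n)` need not belong to `T`.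
theorem hasPartialCompletion_succ_of_forall {K F : Type u} [Field K] [Field F] [Algebra K F]
    {T : Set (ℕ × ℕ)} {m n i : ℕ} (M : ℕ → ℕ → F)
    (hind : AlgebraicIndepOn K (fun e : ℕ × ℕ => M e.1 e.2)
      {e | e ∈ T ∧ e.1 < m ∧ (e.2 < n ∨ e.2 = n ∧ e.1 < i)})
    (h1 : ∀ p ≤ i, BlockRankLE T M p (n + 1))
    (h2 : ∀ p, i ≤ p → p ≤ m → BlockRankLE T M p n)
    (h : ∀ q ≤ n, ∀ r, ¬ HasChain T q (r + 1) (i + 1) (n + 1) →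
      Module.finrank F (blockSpan M i q (n + 1) ⊔ Submodule.span F {Pi.single n 1} :
        Submodule F (ℕ → F)) ≤ r) :
    HasPartialCompletion K T m n (i + 1) := by
  let L := FractionRing F[X]
  let σ : F →+* L := (algebraMap F[X] L).comp C
  let y : L := algebraMap F[X] L X
  have hinj : Function.Injective (algebraMap F[X] L) := IsFractionRing.injective _ _
  have hy : y ≠ 0 := (map_ne_zero_iff _ hinj).2 X_ne_zero
  let M₀ : ℕ → ℕ → L := fun a j => σ (M a j)
  refine ⟨L, inferInstance, inferInstance, pivotUpdate M₀ i n y, ?_, ?_, ?_⟩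
  · have key := algebraicIndepOn_insert_inv_X (K := K) hinj
      (s := {e | e ∈ T ∧ e.1 < m ∧ (e.2 < n ∨ e.2 = n ∧ e.1 < i)}) (e := (i, n)) (by simp)
      (fun e : ℕ × ℕ => pivotUpdate M₀ i n y e.1 e.2)
      (fun e => if e.1 < i ∧ e.2 < n then C (M e.1 e.2) + X * C (M e.1 n * M i e.2)
        else C (M e.1 e.2)) (by
          convert! hind using 2 with e
          split_ifs <;> simp) (by
          rintro ⟨a, j⟩ ⟨-, -, hc⟩
          simp only [pivotUpdate]
          dsimp only at hc
          split_ifs with h3 h4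
          · simp [M₀, σ, y, mul_assoc]
          · omega
          · rfl) (by simp [pivotUpdate, y])
    refine key.mono ?_
    rintro ⟨a, j⟩ ⟨h3, h4, h5⟩
    by_cases h6 : (a, j) = (i, n)
    · exact Or.inl h6
    · refine Or.inr ⟨h3, h4, ?_⟩
      simp only [Prod.mk.injEq, not_and] at h6
      dsimp only at h5 ⊢
      omega
  · intro p hp q r hr
    rcases Nat.lt_or_ge n q with hq | hq
    · rw [blockRank_eq_zero_of_le _ hq]; exact Nat.zero_le _
    rcases Nat.le_succ_iff.1 hp with hp | rfl
    · exact (blockRank_pivotUpdate_of_le M₀ y hq hp).trans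
        ((blockRank_map_le σ M p q (n + 1)).trans (h1 p hp q r hr))
    · refine (blockRank_pivotUpdate_succ M₀ hy hq).trans (le_trans ?_ (h q hq r hr))
      have h3 := blockRank_map_le σ (Function.update M i (Pi.single n 1)) (i + 1) q (n + 1)
      rw [blockRank, blockRank, blockSpan_update_succ, truncRow_single hq] at h3
      refine le_of_eq_of_le (blockRank_congr ?_) h3
      intro a ha j _ _
      rcases Nat.lt_succ_iff_lt_or_eq.1 ha with ha | rfl
      · rw [Function.update_of_ne ha.ne, Function.update_of_ne ha.ne]
      · rw [Function.update_self, Function.update_self]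
        by_cases hj : j = n
        · subst hj; simp
        · simp [hj]
  · intro p hp hpm q r hr
    exact (blockRank_pivotUpdate_of_lt M₀ q y hp).trans
      ((blockRank_map_le σ M p q n).trans (h2 p (by omega) hpm q r hr))

/-- If `(i, n)` is in `T`, it prolongs every chain of the smaller block, which leaves room for a
large entry. Otherwise an entry that keeps the rank of some block down is used if there is one, and
a large entry if there is none. -/
theorem HasPartialCompletion.succ_row {K : Type u} [Field K] {T : Set (ℕ × ℕ)} {m n i : ℕ}
    (him : i < m) (h : HasPartialCompletion K T m n i) : HasPartialCompletion K T m n (i + 1) := by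
  obtain ⟨F, _, _, M, hind, h1, h2⟩ := h
  by_cases hT : (i, n) ∈ T
  · refine hasPartialCompletion_succ_of_forall M hind h1 h2 fun q hq r hr => ?_
    obtain _ | r := r
    · exact (hr ⟨i, Nat.lt_succ_self i, n, Nat.lt_succ_self n, hq, hT, trivial⟩).elim
    · rw [blockSpan_sup_single M i hq]
      refine (finrank_sup_span_singleton_le _ _).trans (Nat.succ_le_succ ?_)
      exact h2 i le_rfl him.le q r fun hc =>
        hr ⟨i, Nat.lt_succ_self i, n, Nat.lt_succ_self n, hq, hT, hc⟩
  · by_cases hex : ∃ q, q ≤ n ∧ (Pi.single n 1 : ℕ → F) ∉ blockSpan M i q (n + 1) ∧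
      truncRow q n (M i) ∈ blockSpan M i q (n + 1) ⊔ Submodule.span F {Pi.single n 1}
    · obtain ⟨u, hu⟩ := exists_entry_blockRankLE (h1 i le_rfl) (h2 (i + 1) (by omega) him) hex
      refine ⟨F, inferInstance, inferInstance,
        Function.update M i (Function.update (M i) n u), ?_, ?_, ?_⟩
      · have hsub : {e : ℕ × ℕ | e ∈ T ∧ e.1 < m ∧ (e.2 < n ∨ e.2 = n ∧ e.1 < i + 1)} ⊆
            {e | e ∈ T ∧ e.1 < m ∧ (e.2 < n ∨ e.2 = n ∧ e.1 < i)} := by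
          rintro ⟨a, j⟩ ⟨h3, h4, h5⟩
          refine ⟨h3, h4, ?_⟩
          have : (a, j) ≠ (i, n) := fun h => hT (h ▸ h3)
          simp only [ne_eq, Prod.mk.injEq, not_and] at this
          dsimp only at h5 ⊢
          omega
        have hind' := AlgebraicIndepOn.mono hind hsub
        refine algebraicIndepOn_congr ?_ hind'
        rintro ⟨a, j⟩ ⟨h3, -, -⟩
        by_cases ha : a = i
        · subst ha
          have hj : j ≠ n := fun h => hT (h ▸ h3)
          simp [hj]
        · simp [ha]
      · intro p hp
        rcases Nat.le_succ_iff.1 hp with hp | rfl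
        · intro q r hr
          rw [blockRank_congr (M' := M)]
          · exact h1 p hp q r hr
          · intro a ha j _ _
            rw [Function.update_of_ne (by omega)]
        · exact hu
      · intro p hp hpm q r hr
        rw [blockRank_congr (M' := M)]
        · exact h2 p (by omega) hpm q r hr
        · intro a ha j _ hj
          by_cases hai : a = i
          · rw [hai, Function.update_self, Function.update_of_ne (by omega)]
          · rw [Function.update_of_ne hai]
    · push Not at hex
      refine hasPartialCompletion_succ_of_forall M hind h1 h2 fun q hq r hr => ?_
      exact finrank_sup_single_le_of_forall hq (h1 i le_rfl) (h2 (i + 1) (by omega) him)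
        (or_iff_not_imp_left.2 (hex q hq)) hr

theorem hasPartialCompletion (K : Type u) [Field K] (T : Set (ℕ × ℕ)) (m n : ℕ) :
    HasPartialCompletion K T m n 0 := by
  have hzero : ∀ {F : Type u} [Field F] (M : ℕ → ℕ → F) (n : ℕ), ∀ p ≤ 0, BlockRankLE T M p n := by
    intro F _ M n p hp q r _
    obtain rfl : p = 0 := by omega
    have : blockSpan M 0 q n = ⊥ := by
      rw [eq_bot_iff, blockSpan_le]
      intro i hi
      omega
    rw [blockRank, this, finrank_bot]
    exact Nat.zero_le _
  induction n with
  | zero =>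
    refine ⟨K, inferInstance, inferInstance, 0, ?_, hzero _ _, ?_⟩
    · have : {e : ℕ × ℕ | e ∈ T ∧ e.1 < m ∧ (e.2 < 0 ∨ e.2 = 0 ∧ e.1 < 0)} = ∅ := by
        ext e; simp
      rw [this]
      exact algebraicIndependent_empty_type
    · intro p _ _ q r _
      rw [blockRank_eq_zero_of_le _ (Nat.zero_le q)]
      exact Nat.zero_le _
  | succ n ih =>
    have hrow : ∀ i ≤ m, HasPartialCompletion K T m n i := by
      intro i hi
      induction i with
      | zero => exact ih
      | succ i ihi => exact (ihi (by omega)).succ_row (by omega)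
    obtain ⟨F, _, _, M, hind, h1, -⟩ := hrow m le_rfl
    refine ⟨F, inferInstance, inferInstance, M, ?_, hzero M _, fun p _ hpm => h1 p hpm⟩
    refine AlgebraicIndepOn.mono hind ?_
    rintro ⟨a, j⟩ ⟨h3, h4, h5⟩
    refine ⟨h3, h4, ?_⟩
    dsimp only at h4 h5 ⊢
    omega

/-- Generic values on any set `T` of cells extend to a matrix in which the rank of every upper right
block is at most the length of the longest chain of `T` in this block. -/
theorem exists_completion (K : Type u) [Field K] (T : Set (ℕ × ℕ)) (m n : ℕ) :
    ∃ (F : Type u) (_ : Field F) (_ : Algebra K F) (M : ℕ → ℕ → F),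
      AlgebraicIndepOn K (fun e : ℕ × ℕ => M e.1 e.2) {e | e ∈ T ∧ e.1 < m ∧ e.2 < n} ∧
      ∀ p ≤ m, BlockRankLE T M p n := by
  obtain ⟨F, _, _, M, hind, -, h2⟩ := hasPartialCompletion K T m n
  exact ⟨F, inferInstance, inferInstance, M,
    AlgebraicIndepOn.mono hind fun e h => ⟨h.1, h.2.1, Or.inl h.2.2⟩,
    fun p hp => h2 p (Nat.zero_le p) hp⟩

/-! ### Independence of crossing-free sets -/

open Polynomial in
-- The substitution x_c ↦ X^(d c) x_c is injective on polynomials because setting X = 1 undoes it.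
theorem algebraicIndependent_X_pow_mul {ι K F : Type*} [Field K] [Field F] [Algebra K F]
    (g : ι → F[X]) (hg : AlgebraicIndependent K fun c => (g c).eval 0) (d : ι → ℕ) :
    AlgebraicIndependent K fun c => X ^ d c * g c := by
  have h1 := algebraicIndependent_option_X g hg
  let θ : MvPolynomial ι K →ₐ[K] MvPolynomial (Option ι) K :=
    MvPolynomial.aeval fun c => MvPolynomial.X none ^ d c * MvPolynomial.X (some c)
  let τ : MvPolynomial (Option ι) K →ₐ[K] MvPolynomial ι K :=
    MvPolynomial.aeval fun o => o.elim 1 MvPolynomial.X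
  have hθ : Function.Injective θ := by
    apply Function.LeftInverse.injective (g := τ)
    have : τ.comp θ = AlgHom.id K _ := by
      ext c
      simp [θ, τ]
    exact fun P => congrArg (fun f : MvPolynomial ι K →ₐ[K] MvPolynomial ι K => f P) this
  rw [algebraicIndependent_iff_injective_aeval] at h1 ⊢
  have h2 : (MvPolynomial.aeval fun c => X ^ d c * g c : MvPolynomial ι K →ₐ[K] F[X]) =
      (MvPolynomial.aeval fun o : Option ι => o.elim X g).comp θ := by
    ext c : 1
    simp [θ]
  rw [h2]
  exact h1.comp hθ

theorem HasChain.le_rows {T : Set (ℕ × ℕ)} {q m p n : ℕ} (h : HasChain T q m p n) : m ≤ p := by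
  induction m generalizing p n with
  | zero => exact Nat.zero_le p
  | succ m ih =>
    obtain ⟨i, hi, j, hj, -, -, hc⟩ := h
    have := ih hc
    omega

/-- The cells of the edges in `T`, shifted by `k`, together with a `k × k` block of further cells
in `k` new rows above and `k` new columns to the right. -/
def cornerExtension {n : ℕ} (k : ℕ) (T : Set (KEdge n)) : Set (ℕ × ℕ) :=
  {c | (∃ e ∈ T, c = (k + e.1.1, k + e.1.2)) ∨ c.1 < k ∧ k + n ≤ c.2}

/-- Since `p ≤ q`, every row index of the chain is below every column index, so increasing cells are
crossing edges. The bound on `n'` keeps the chain out of the corner block. -/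
theorem exists_isMCrossing_of_hasChain {n k : ℕ} {T : Set (KEdge n)} {q m p n' : ℕ}
    (h : HasChain (cornerExtension k T) q m p n') (hpq : p ≤ q) (hn : n' ≤ k + n) :
    ∃ C : Finset (KEdge n), IsMCrossing m C ∧ (C : Set (KEdge n)) ⊆ T ∧
      ∀ e ∈ C, k + e.1.1 < p ∧ k + e.1.2 < n' ∧ q ≤ k + e.1.2 := by
  classical
  induction m generalizing p n' with
  | zero => exact ⟨∅, ⟨rfl, by simp⟩, by simp, by simp⟩
  | succ m ih =>
    obtain ⟨i, hi, j, hj, hq, hT, hc⟩ := h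
    obtain ⟨e, heT, he⟩ | ⟨-, h2⟩ := hT
    · rw [Prod.mk.injEq] at he
      obtain ⟨rfl, rfl⟩ := he
      obtain ⟨C, ⟨hcard, hcr⟩, hCT, hCb⟩ := ih hc (by omega) (by omega)
      have heC : e ∉ C := fun h => lt_irrefl _ (hCb e h).1
      have hcross : ∀ f ∈ C, f.Crosses e := by
        intro f hf
        have := hCb f hf
        left
        simp only [Fin.lt_def]
        omega
      refine ⟨insert e C, ⟨by rw [Finset.card_insert_of_notMem heC, hcard], ?_⟩, ?_, ?_⟩
      · intro f hf g hg hfg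
        rw [Finset.mem_insert] at hf hg
        obtain rfl | hf := hf
        · obtain rfl | hg := hg
          · exact absurd rfl hfg
          · exact (hcross g hg).symm
        · obtain rfl | hg := hg
          · exact hcross f hf
          · exact hcr f hf g hg hfg
      · rw [Finset.coe_insert]
        exact Set.insert_subset heT hCT
      · intro f hf
        rw [Finset.mem_insert] at hf
        obtain rfl | hf := hf
        · exact ⟨hi, hj, hq⟩
        · have := hCb f hf
          omega
    · dsimp only at h2
      omega

/-- A chain whose last cell is in the corner lies in the first `k` rows and has at most `k` cells.
If its last cell comes from `T`, the whole chain stays left of the corner and is a crossing of `T`.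
-/
theorem not_hasChain_cornerExtension {n k : ℕ} {T : Set (KEdge n)}
    (hT : IsCrossingFree (k + 1) T) {q p n' : ℕ} (hpq : p ≤ q) :
    ¬ HasChain (cornerExtension k T) q (k + 1) p n' := by
  rintro ⟨i, hi, j, hj, hq, hcell, hc⟩
  by_cases hik : i < k ∧ k + n ≤ j
  · have := hc.le_rows
    omega
  · have hjn : j + 1 ≤ k + n := by
      obtain ⟨e, -, he⟩ | h := hcell
      · rw [Prod.mk.injEq] at he
        omega
      · exact absurd h hik
    obtain ⟨C, hC, hCT, -⟩ := exists_isMCrossing_of_hasChain (m := k + 1) (n' := j + 1)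
      ⟨i, hi, j, Nat.lt_succ_self j, hq, hcell, hc⟩ hpq hjn
    exact hT C hC hCT

theorem det_ne_zero_of_algebraicIndependent {K F : Type*} [Field K] [Field F] [Algebra K F] {k : ℕ}
    (N : Matrix (Fin k) (Fin k) F)
    (hN : AlgebraicIndependent K fun c : Fin k × Fin k => N c.1 c.2) : N.det ≠ 0 := by
  have h1 := Matrix.det_mvPolynomialX_ne_zero (Fin k) K
  intro h
  apply h1
  apply hN.eq_zero_of_aeval_eq_zero
  rw [AlgHom.map_det]
  convert! h
  ext i j
  simp [Matrix.mvPolynomialX]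

/-- The first `k` rows are independent already on the columns s, …, s+k-1, so they are a basis of a
row space of dimension at most `k`. -/
theorem exists_mul_of_blockRank_le {F : Type*} [Field F] {M : ℕ → ℕ → F} {k p q N s : ℕ}
    (hrank : blockRank M p q N ≤ k) (hs : q ≤ s) (hsN : s + k ≤ N) (hk : k ≤ p)
    (hdet : (Matrix.of fun r c : Fin k => M r (s + c)).det ≠ 0) {i : ℕ} (hi : i < p) :
    ∃ α : Fin k → F, ∀ j, q ≤ j → j < N → M i j = ∑ r, α r * M r j := by
  let v : Fin k → ℕ → F := fun r => truncRow q N (M r)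
  have hv : LinearIndependent F v := by
    let π : (ℕ → F) →ₗ[F] (Fin k → F) := LinearMap.pi fun c => LinearMap.proj (s + c : ℕ)
    have h1 : LinearIndependent F (π ∘ v) := by
      have h2 : LinearIndependent F (Matrix.of fun r c : Fin k => M r (s + c)).row :=
        Matrix.linearIndependent_rows_iff_isUnit.2
          ((Matrix.isUnit_iff_isUnit_det _).2 hdet.isUnit)
      convert! h2 using 1
      ext r c
      have : q ≤ s + c ∧ s + c < N := by omega
      simp [π, v, truncRow_apply, this, Matrix.row]
    exact LinearIndependent.of_comp π h1
  have hle : Submodule.span F (Set.range v) ≤ blockSpan M p q N := by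
    rw [Submodule.span_le]
    rintro _ ⟨r, rfl⟩
    exact truncRow_mem_blockSpan M q N (by omega)
  have heq : Submodule.span F (Set.range v) = blockSpan M p q N := by
    apply Submodule.eq_of_le_of_finrank_le hle
    rw [finrank_span_eq_card hv, Fintype.card_fin]
    exact hrank
  have hmem := truncRow_mem_blockSpan M q N hi
  rw [← heq, Submodule.mem_span_range_iff_exists_fun] at hmem
  obtain ⟨α, hα⟩ := hmem
  refine ⟨α, fun j hj hjN => ?_⟩
  have h1 := congrFun hα j
  simp only [Finset.sum_apply, Pi.smul_apply, smul_eq_mul, v, truncRow_apply, hj, hjN, and_self,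
    if_true] at h1
  exact h1.symm

/-- Over an extension field there are `a_i, b_j ∈ F^k` such that the products `a_i ⬝ b_j`, `{i < j}`
in a given `(k + 1)`-free set, are algebraically independent. -/
theorem exists_algebraicIndepOn_dotProduct (K : Type u) [Field K] {k n : ℕ} {T : Set (KEdge n)}
    (hT : IsCrossingFree (k + 1) T) :
    ∃ (F : Type u) (_ : Field F) (_ : Algebra K F) (a b : Fin n → Fin k → F),
      AlgebraicIndepOn K (fun e : KEdge n => ∑ l, a e.1.1 l * b e.1.2 l) T := by
  obtain ⟨F, _, _, M, hind, hrank⟩ :=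
    exists_completion K (cornerExtension k T) (k + n) (k + n + k)
  have hdet : (Matrix.of fun r c : Fin k => M r (k + n + c)).det ≠ 0 := by
    apply det_ne_zero_of_algebraicIndependent (K := K)
    have h1 := AlgebraicIndependent.comp hind
      (fun c : Fin k × Fin k => ⟨((c.1 : ℕ), k + n + c.2), Or.inr ⟨c.1.2, by simp⟩, by
        dsimp only; omega, by dsimp only; omega⟩) (by
        rintro ⟨r, c⟩ ⟨r', c'⟩ h
        simp only [Subtype.mk.injEq, Prod.mk.injEq] at h
        simp only [Prod.mk.injEq, Fin.ext_iff]
        omega)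
    exact h1
  -- The part of row k+i to the right of the diagonal lies in a block of rank at most k. One vector
  -- α serves all these columns at once.
  have hα : ∀ i : Fin n, ∃ α : Fin k → F, ∀ j, k + i + 1 ≤ j → j < k + n + k →
      M (k + i) j = ∑ r, α r * M r j := fun i =>
    exists_mul_of_blockRank_le (s := k + n)
      (hrank (k + i + 1) (by omega) (k + i + 1) k (not_hasChain_cornerExtension hT le_rfl))
      (by omega) (by omega) (by omega) hdet (Nat.lt_succ_self _)
  choose α hα using hα
  refine ⟨F, inferInstance, inferInstance, α, fun j r => M r (k + j), ?_⟩
  have h1 := AlgebraicIndependent.comp hind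
    (fun e : T => ⟨(k + e.1.1.1, k + e.1.1.2), Or.inl ⟨e, e.2, rfl⟩, by
      dsimp only; omega, by dsimp only; omega⟩) (by
      rintro ⟨e, he⟩ ⟨f, hf⟩ h
      simp only [Subtype.mk.injEq, Prod.mk.injEq] at h
      simp only [Subtype.ext_iff, Prod.ext_iff, Fin.ext_iff]
      omega)
  refine algebraicIndepOn_congr (x := fun e : KEdge n => M (k + e.1.1) (k + e.1.2)) ?_ h1
  intro e _
  have := e.2
  exact hα e.1.1 (k + e.1.2) (by simp only [Fin.lt_def] at this; omega) (by omega)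

open Polynomial in
/-- The coordinates of the parametrization that belong to a `(k + 1)`-free set of edges are
algebraically independent. -/
theorem algebraicIndepOn_pairParamPoly_of_isCrossingFree (K : Type u) [Field K] {k n : ℕ}
    {T : Set (KEdge n)} (hT : IsCrossingFree (k + 1) T) :
    AlgebraicIndepOn K (pairParamPoly K k n) T := by
  obtain ⟨F, _, _, a, b, hind⟩ := exists_algebraicIndepOn_dotProduct K hT
  -- Weights i on a_i and n-i on b_i: for i < j the product a_i·b_j gets the exponent n-j+i and
  -- a_j·b_i one larger by 2(j-i) > 0, so after division by the common power only a_i·b_j survives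
  -- at X = 0.
  let φ : MvPolynomial (PairIndex k n) K →ₐ[K] F[X] := MvPolynomial.aeval (Sum.elim
    (fun li => C (a li.2 li.1) * X ^ (li.2 : ℕ)) (fun lj => C (b lj.2 lj.1) * X ^ (n - lj.2)))
  have hφ : ∀ e : KEdge n, φ (pairParamPoly K k n e) = X ^ (n - e.1.2 + e.1.1) *
      (C (∑ l, a e.1.1 l * b e.1.2 l) -
        X ^ (2 * (e.1.2 - e.1.1 : ℕ)) * C (∑ l, a e.1.2 l * b e.1.1 l)) := by
    intro e
    have he : (e.1.1 : ℕ) < e.1.2 := e.2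
    have hexp : (e.1.2 : ℕ) + (n - e.1.1) = n - e.1.2 + e.1.1 + 2 * (e.1.2 - e.1.1 : ℕ) := by omega
    simp only [φ, pairParamPoly, map_sum, map_sub, map_mul, MvPolynomial.aeval_X, Sum.elim_inl,
      Sum.elim_inr, mul_sub, Finset.mul_sum, ← Finset.sum_sub_distrib]
    refine Finset.sum_congr rfl fun l _ => ?_
    congr 1
    · rw [pow_add]; ring
    · have hX : (X : F[X]) ^ (e.1.2 : ℕ) * X ^ (n - e.1.1 : ℕ) =
          X ^ (n - e.1.2 + e.1.1 : ℕ) * X ^ (2 * (e.1.2 - e.1.1 : ℕ)) := by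
        rw [← pow_add, hexp, pow_add]
      linear_combination (C (a e.1.2 l) * C (b e.1.1 l)) * hX
  refine AlgebraicIndependent.of_comp φ ?_
  have h1 := algebraicIndependent_X_pow_mul (K := K)
    (fun e : T => C (∑ l, a e.1.1.1 l * b e.1.1.2 l) -
        X ^ (2 * (e.1.1.2 - e.1.1.1 : ℕ)) * C (∑ l, a e.1.1.2 l * b e.1.1.1 l))
    (by
      convert! hind using 2 with e
      have he : (e.1.1.1 : ℕ) < e.1.1.2 := e.1.2
      have : 2 * (e.1.1.2 - e.1.1.1 : ℕ) ≠ 0 := by omega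
      simp [eval_finsetSum, this])
    (fun e : T => n - e.1.1.2 + e.1.1.1)
  convert! h1 using 2 with e
  exact hφ e

/-! ### Counting the edges missing from a k-triangulation -/

/-- The number of entries greater than `q` among the first `p` entries of `w`. -/
def prefixRank (w : ℕ → ℕ) (p q : ℕ) : ℕ :=
  ((Finset.range p).filter fun a => q < w a).card

theorem prefixRank_succ (w : ℕ → ℕ) (p q : ℕ) :
    prefixRank w (p + 1) q = prefixRank w p q + if q < w p then 1 else 0 := by
  rw [prefixRank, prefixRank, Finset.range_add_one, Finset.filter_insert]
  split_ifs with h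
  · rw [Finset.card_insert_of_notMem (by simp)]
  · rfl

theorem prefixRank_succ' (w : ℕ → ℕ) (p q : ℕ) :
    prefixRank w (p + 1) q = prefixRank (fun a => w (a + 1)) p q + if q < w 0 then 1 else 0 := by
  induction p with
  | zero => rw [prefixRank_succ]; rfl
  | succ p ih => rw [prefixRank_succ, ih, prefixRank_succ]; omega

/-- The number of pairs of positions `a < b < N` with `w a < w b`. -/
def ascentCount (w : ℕ → ℕ) (N : ℕ) : ℕ :=
  ((Finset.range N ×ˢ Finset.range N).filter fun ab => ab.1 < ab.2 ∧ w ab.1 < w ab.2).card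

theorem ascentCount_tail_le (w : ℕ → ℕ) (N : ℕ) :
    ascentCount (fun a => w (a + 1)) N ≤ ascentCount w (N + 1) := by
  refine Finset.card_le_card_of_injOn (fun ab => (ab.1 + 1, ab.2 + 1)) ?_ ?_
  · rintro ⟨a, b⟩ h
    simp only [Finset.coe_filter, Finset.mem_product, Finset.mem_range, Set.mem_ofPred_eq] at h ⊢
    exact ⟨⟨by omega, by omega⟩, by omega, h.2.2⟩
  · rintro ⟨a, b⟩ - ⟨c, d⟩ - h
    simp only [Prod.mk.injEq] at h ⊢
    omega

/-- The swap of positions carries ascents of the new sequence injectively to ascents of `w` other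
than (i, i+1). -/
theorem ascentCount_swap_lt (w : ℕ → ℕ) {i N : ℕ} (hi : i + 1 < N) (hw : w i < w (i + 1)) :
    ascentCount (w ∘ Equiv.swap i (i + 1)) N + 1 ≤ ascentCount w N := by
  have hmem : (i, i + 1) ∈ (Finset.range N ×ˢ Finset.range N).filter
      fun ab : ℕ × ℕ => ab.1 < ab.2 ∧ w ab.1 < w ab.2 := by
    simp only [Finset.mem_filter, Finset.mem_product, Finset.mem_range]
    omega
  rw [ascentCount, ascentCount, ← Finset.card_erase_add_one hmem]
  refine Nat.succ_le_succ (Finset.card_le_card_of_injOn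
    (fun ab : ℕ × ℕ => (Equiv.swap i (i + 1) ab.1, Equiv.swap i (i + 1) ab.2)) ?_ ?_)
  · rintro ⟨a, b⟩ h
    simp only [Finset.coe_filter, Finset.mem_product, Finset.mem_range, Set.mem_ofPred_eq,
      Function.comp_apply] at h
    simp only [Finset.coe_erase, Finset.coe_filter, Set.mem_sdiff, Finset.mem_product,
      Finset.mem_range, Set.mem_ofPred_eq, Set.mem_singleton_iff, Prod.mk.injEq]
    obtain ⟨⟨ha, hb⟩, hab, hwab⟩ := h
    refine ⟨⟨?_, ?_, hwab⟩, ?_⟩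
    all_goals
      simp only [Equiv.swap_apply_def] at hwab ⊢
      split_ifs at hwab ⊢ <;> subst_vars <;> omega
  · rintro ⟨a, b⟩ - ⟨c, d⟩ - h
    simpa only [Prod.mk.injEq, EmbeddingLike.apply_eq_iff_eq] using h

theorem prefixRank_swap_of_ne (w : ℕ → ℕ) {i p : ℕ} (hp : p ≠ i + 1) (q : ℕ) :
    prefixRank (w ∘ Equiv.swap i (i + 1)) p q = prefixRank w p q := by
  have hlow : ∀ p ≤ i, prefixRank (w ∘ Equiv.swap i (i + 1)) p q = prefixRank w p q := by
    intro p hp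
    rw [prefixRank, prefixRank]
    congr 1
    refine Finset.filter_congr fun a ha => ?_
    rw [Finset.mem_range] at ha
    rw [Function.comp_apply, Equiv.swap_apply_of_ne_of_ne (by omega) (by omega)]
  rcases Nat.lt_or_ge i p with h | h
  · obtain ⟨d, rfl⟩ := Nat.exists_eq_add_of_le (show i + 2 ≤ p by omega)
    induction d with
    | zero =>
      rw [add_zero, prefixRank_succ, prefixRank_succ, prefixRank_succ w, prefixRank_succ w,
        hlow i le_rfl]
      simp only [Function.comp_apply, Equiv.swap_apply_left, Equiv.swap_apply_right]
      omega
    | succ d ih =>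
      rw [← add_assoc, prefixRank_succ, prefixRank_succ w, ih (by omega) (by omega),
        Function.comp_apply, Equiv.swap_apply_of_ne_of_ne (by omega) (by omega)]
  · exact hlow p h

theorem prefixRank_swap_self (w : ℕ → ℕ) (i q : ℕ) :
    prefixRank (w ∘ Equiv.swap i (i + 1)) (i + 1) q =
      prefixRank w i q + if q < w (i + 1) then 1 else 0 := by
  rw [prefixRank_succ, prefixRank_swap_of_ne w (by omega), Function.comp_apply,
    Equiv.swap_apply_left]

theorem HasChain.of_forall {T T' : Set (ℕ × ℕ)} {q m p n : ℕ} (h : HasChain T q m p n)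
    (hT : ∀ i < p, ∀ j < n, q ≤ j → (i, j) ∈ T → (i, j) ∈ T') : HasChain T' q m p n := by
  induction m generalizing p n with
  | zero => trivial
  | succ m ih =>
    obtain ⟨i, hi, j, hj, hq, hm, hc⟩ := h
    exact ⟨i, hi, j, hj, hq, hT i hi j hj hq hm,
      ih hc fun a ha b hb => hT a (ha.trans hi) b (hb.trans hj)⟩

theorem HasChain.le_cols {T : Set (ℕ × ℕ)} {q m p n : ℕ} (h : HasChain T q m p n) :
    m ≤ n - q := by
  induction m generalizing p n with
  | zero => exact Nat.zero_le _
  | succ m ih =>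
    obtain ⟨i, hi, j, hj, hq, -, hc⟩ := h
    have := ih hc
    omega

/-- The cells in rows `< m` and columns `< n`, and those in the first `s` rows of column `n`. -/
def partialCells (m n s : ℕ) : Finset (ℕ × ℕ) :=
  (Finset.range m ×ˢ Finset.range (n + 1)).filter fun c => c.2 < n ∨ c.1 < s

theorem mem_partialCells {m n s i j : ℕ} :
    (i, j) ∈ partialCells m n s ↔ i < m ∧ (j < n ∨ j = n ∧ i < s) := by
  simp only [partialCells, Finset.mem_filter, Finset.mem_product, Finset.mem_range]
  omega

/-- The chains of `T` are bounded by the ranks of `w`, when the cells of `partialCells m n s` are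
taken into account. -/
def ChainsBounded (m : ℕ) (T : Set (ℕ × ℕ)) (n s : ℕ) (w : ℕ → ℕ) : Prop :=
  (∀ p ≤ s, ∀ q ≤ n, ∀ r, HasChain T q r p (n + 1) → r ≤ prefixRank w p q) ∧
  -- This is the bound needed if all cells (p, n) with s ≤ p ≤ m were present, since each prolongs
  -- the chains in rows < p and columns < n by one. Row `m` is an extra row beyond the actual cells.
  ∀ p, s ≤ p → p ≤ m → ∀ q ≤ n, ∀ r, HasChain T q r p n → r + 1 ≤ prefixRank w (p + 1) q

/-- The chains that end in `(s, n)` are the ones that the second half of `ChainsBounded` anticipates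
for p = s. Together with `ChainsBounded.insert`, this lets the cell be dropped from `T` with `w`
unchanged. -/
theorem ChainsBounded.of_insert {m n s : ℕ} {T : Set (ℕ × ℕ)} {w : ℕ → ℕ}
    (h : ChainsBounded m (insert (s, n) T) n (s + 1) w) : ChainsBounded m T n s w := by
  refine ⟨fun p hp q hq r hr => ?_, fun p hp hpm q hq r hr => ?_⟩
  · exact h.1 p (by omega) q hq r (hr.mono (Set.subset_insert _ _) le_rfl le_rfl)
  · rcases Nat.eq_or_lt_of_le hp with rfl | hp
    · exact h.1 (s + 1) le_rfl q hq (r + 1) ⟨s, Nat.lt_succ_self s, n, Nat.lt_succ_self n, hq,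
        Set.mem_insert _ _, hr.mono (Set.subset_insert _ _) le_rfl le_rfl⟩
    · exact h.2 p hp hpm q hq r (hr.mono (Set.subset_insert _ _) le_rfl le_rfl)

theorem ChainsBounded.insert {m n s : ℕ} {T : Set (ℕ × ℕ)} {w : ℕ → ℕ} (hs : s < m)
    (h : ChainsBounded m T n s w) : ChainsBounded m (insert (s, n) T) n (s + 1) w := by
  have hne : ∀ {q r p n'}, p ≤ s ∨ n' ≤ n → HasChain (Insert.insert (s, n) T) q r p n' →
      HasChain T q r p n' := by
    intro q r p n' hpn hc
    refine hc.of_forall fun i hi j hj _ hij => hij.resolve_left ?_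
    rw [Prod.mk.injEq]
    omega
  refine ⟨fun p hp q hq r hr => ?_, fun p hp hpm q hq r hr => ?_⟩
  · rcases Nat.le_succ_iff.1 hp with hp | rfl
    · exact h.1 p hp q hq r (hne (Or.inl hp) hr)
    · obtain _ | r := r
      · exact Nat.zero_le _
      · obtain ⟨i, hi, j, hj, -, -, hc⟩ := hr
        exact h.2 s le_rfl hs.le q hq r (hne (Or.inl le_rfl)
          (hc.mono subset_rfl (by omega) (by omega)))
  · exact h.2 p (by omega) hpm q hq r (hne (Or.inr le_rfl) hr)

theorem ChainsBounded.le_of_succ {m n s : ℕ} {T : Set (ℕ × ℕ)} {w : ℕ → ℕ} (hs : s < m)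
    (h : ChainsBounded m T n (s + 1) w) {q r : ℕ} (hq : q ≤ n) (hr : HasChain T q r s n) :
    r + 1 ≤ prefixRank w s q + 1 ∧
      r + 1 ≤ prefixRank w s q + (if q < w s then 1 else 0) + if q < w (s + 1) then 1 else 0 := by
  have h1 := h.1 s (Nat.le_succ s) q hq r (hr.mono subset_rfl le_rfl (Nat.le_succ n))
  have h2 := h.2 (s + 1) le_rfl hs q hq r (hr.mono subset_rfl (Nat.le_succ s) le_rfl)
  rw [prefixRank_succ, prefixRank_succ] at h2
  exact ⟨by omega, h2⟩

/-- Without an ascent at `s` the bounds leave room for the cell `(s, n)`. Hence, for maximal `T`, a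
missing cell forces an ascent. -/
theorem ChainsBounded.of_succ {m n s : ℕ} {T : Set (ℕ × ℕ)} {w : ℕ → ℕ} (hs : s < m)
    (hw : w (s + 1) ≤ w s) (h : ChainsBounded m T n (s + 1) w) : ChainsBounded m T n s w := by
  refine ⟨fun p hp => h.1 p (by omega), fun p hp hpm q hq r hr => ?_⟩
  rcases Nat.eq_or_lt_of_le hp with rfl | hp
  · have := h.le_of_succ hs hq hr
    rw [prefixRank_succ]
    split_ifs at this ⊢ <;> omega
  · exact h.2 p hp hpm q hq r hr

theorem ChainsBounded.swap_of_succ {m n s : ℕ} {T : Set (ℕ × ℕ)} {w : ℕ → ℕ} (hs : s < m)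
    (hw : w s < w (s + 1)) (h : ChainsBounded m T n (s + 1) w) :
    ChainsBounded m T n s (w ∘ Equiv.swap s (s + 1)) := by
  refine ⟨fun p hp q hq r hr => ?_, fun p hp hpm q hq r hr => ?_⟩
  · rw [prefixRank_swap_of_ne w (by omega)]
    exact h.1 p (by omega) q hq r hr
  · rcases Nat.eq_or_lt_of_le hp with rfl | hp
    · have := h.le_of_succ hs hq hr
      rw [prefixRank_swap_self]
      split_ifs at this ⊢ <;> omega
    · rw [prefixRank_swap_of_ne w (by omega)]
      exact h.2 p hp hpm q hq r hr

/-- This carries maximality of `T` over to the swapped sequence: a cell that could be added there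
could be added for `w`. -/
theorem ChainsBounded.succ_of_swap {m n s : ℕ} {T : Set (ℕ × ℕ)} {w : ℕ → ℕ} (hs : s < m)
    (hT : (s, n) ∉ T) (h : ChainsBounded m T n s (w ∘ Equiv.swap s (s + 1))) :
    ChainsBounded m T n (s + 1) w := by
  refine ⟨fun p hp q hq r hr => ?_, fun p hp hpm q hq r hr => ?_⟩
  · rcases Nat.le_succ_iff.1 hp with hp | rfl
    · have := h.1 p hp q hq r hr
      rwa [prefixRank_swap_of_ne w (by omega)] at this
    · obtain _ | r := r
      · exact Nat.zero_le _
      obtain ⟨i, hi, j, hj, hqj, hij, hc⟩ := hr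
      by_cases hjn : j = n
      · have his : i < s := by
          refine lt_of_le_of_ne (by omega) fun h => hT ?_
          rwa [hjn, h] at hij
        have := h.1 s le_rfl q hq (r + 1) ⟨i, his, j, hj, hqj, hij, hc⟩
        rw [prefixRank_swap_of_ne w (by omega)] at this
        rw [prefixRank_succ]
        omega
      · have := h.2 (s + 1) (Nat.le_succ s) hs q hq (r + 1)
          ⟨i, hi, j, by omega, hqj, hij, hc⟩
        rw [prefixRank_swap_of_ne w (by omega), prefixRank_succ] at this
        simp only [Nat.succ_eq_add_one]
        split_ifs at this <;> omega
  · have := h.2 p (by omega) hpm q hq r hr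
    rwa [prefixRank_swap_of_ne w (by omega)] at this

/-- A maximal set of cells with bounded chains has at most as many cells in its complement as the
bounding sequence has ascents. -/
def ComplementBounded (m n s : ℕ) : Prop :=
  ∀ (T : Finset (ℕ × ℕ)) (w : ℕ → ℕ), (∀ q ≤ n, n + 1 - q ≤ prefixRank w (m + 1) q) →
    ChainsBounded m T n s w →
    (∀ c ∈ partialCells m n s, c ∉ T → ¬ ChainsBounded m (insert c (T : Set (ℕ × ℕ))) n s w) →
    T ⊆ partialCells m n s → (partialCells m n s \ T).card ≤ ascentCount w (m + 1 + n)

/-- A cell of `T` is dropped at no cost. A missing cell forces an ascent at `s`, and swapping that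
ascent away pays for it. -/
theorem ComplementBounded.succ_row {m n s : ℕ} (hs : s < m) (h : ComplementBounded m n s) :
    ComplementBounded m n (s + 1) := by
  intro T w hw hT hmax hsub
  have hcell : ∀ {c}, c ∈ partialCells m n (s + 1) ↔ c = (s, n) ∨ c ∈ partialCells m n s := by
    rintro ⟨i, j⟩
    rw [mem_partialCells, mem_partialCells, Prod.mk.injEq]
    omega
  have hnot : (s, n) ∉ partialCells m n s := by
    rw [mem_partialCells]
    omega
  by_cases he : (s, n) ∈ T
  · have hins : (insert (s, n) (T.erase (s, n) : Finset (ℕ × ℕ)) : Set (ℕ × ℕ)) = T := by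
      rw [← Finset.coe_insert, Finset.insert_erase he]
    have hsub' : T.erase (s, n) ⊆ partialCells m n s := by
      intro c hc
      rw [Finset.mem_erase] at hc
      exact (hcell.1 (hsub hc.2)).resolve_left hc.1
    have heq : partialCells m n (s + 1) \ T = partialCells m n s \ T.erase (s, n) := by
      ext c
      rw [Finset.mem_sdiff, Finset.mem_sdiff, hcell, Finset.mem_erase]
      by_cases hc : c = (s, n)
      · subst hc; simp [he, hnot]
      · simp [hc]
    rw [heq]
    refine h _ w hw (ChainsBounded.of_insert (by rwa [hins])) ?_ hsub'
    intro c hc hcT hb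
    have hne : c ≠ (s, n) := fun h => hnot (h ▸ hc)
    refine hmax c (hcell.2 (Or.inr hc)) (fun h => hcT (Finset.mem_erase.2 ⟨hne, h⟩)) ?_
    have := hb.insert hs
    rwa [Set.insert_comm, hins] at this
  · have hsub' : T ⊆ partialCells m n s := fun c hc =>
      (hcell.1 (hsub hc)).resolve_left fun h => he (h ▸ hc)
    have hws : w s < w (s + 1) := by
      by_contra hws
      exact hmax _ (hcell.2 (Or.inl rfl)) he ((hT.of_succ hs (not_lt.1 hws)).insert hs)
    have heq : partialCells m n (s + 1) \ T = insert (s, n) (partialCells m n s \ T) := by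
      ext c
      rw [Finset.mem_insert, Finset.mem_sdiff, Finset.mem_sdiff, hcell]
      by_cases hc : c = (s, n)
      · subst hc; simp [he]
      · simp [hc]
    rw [heq, Finset.card_insert_of_notMem (by simp [hnot])]
    refine le_trans (Nat.succ_le_succ (h T (w ∘ Equiv.swap s (s + 1)) ?_ (hT.swap_of_succ hs hws)
      ?_ hsub')) (ascentCount_swap_lt w (by omega) hws)
    · intro q hq
      rw [prefixRank_swap_of_ne w (by omega)]
      exact hw q hq
    · intro c hc hcT hb
      refine hmax c (hcell.2 (Or.inr hc)) hcT (hb.succ_of_swap hs ?_)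
      rw [Set.mem_insert_iff, not_or]
      exact ⟨fun h => hnot (h ▸ hc), he⟩

/-- The bound for p = 0 forces w 0 > n+1, so w 0 is counted in every nonempty prefix. Deleting it
turns the shifted bounds for the new column into the ordinary bounds for the previous one. -/
theorem ComplementBounded.succ_column {m n : ℕ} (h : ComplementBounded m n m) :
    ComplementBounded m (n + 1) 0 := by
  intro T w hw hT hmax hsub
  have heq : partialCells m (n + 1) 0 = partialCells m n m := by
    ext ⟨i, j⟩
    rw [mem_partialCells, mem_partialCells]
    omega
  have hw' : ∀ q ≤ n, n + 1 - q ≤ prefixRank (fun a => w (a + 1)) (m + 1) q := by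
    intro q hq
    have h1 := hw q (by omega)
    have h2 := prefixRank_succ w (m + 1) q
    rw [prefixRank_succ'] at h2
    split_ifs at h2 <;> omega
  have hw0 : ∀ q ≤ n + 1, q < w 0 := by
    intro q hq
    have h1 := hT.2 0 le_rfl (Nat.zero_le m) q hq 0 trivial
    rw [prefixRank_succ] at h1
    by_contra hlt
    simp [hlt, prefixRank] at h1
  rw [heq] at hmax hsub ⊢
  refine (h T (fun a => w (a + 1)) hw' ⟨fun p hp q hq r hr => ?_, fun p hp hpm q hq r hr => ?_⟩
    ?_ hsub).trans (ascentCount_tail_le w (m + 1 + n))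
  · have := hT.2 p (Nat.zero_le p) hp q (by omega) r hr
    rw [prefixRank_succ'] at this
    split_ifs at this <;> omega
  · have h1 := hw' q hq
    have h2 := hr.le_cols
    obtain rfl : p = m := le_antisymm hpm hp
    omega
  · intro c hc hcT hb
    refine hmax c hc hcT ⟨fun p hp q _ r hr => ?_, fun p _ hpm q hq r hr => ?_⟩
    · have := hr.le_rows
      omega
    · rw [prefixRank_succ', if_pos (hw0 q hq)]
      rcases Nat.le_succ_iff.1 hq with hq | rfl
      · exact Nat.succ_le_succ (hb.1 p hpm q hq r hr)
      · have := hr.le_cols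
        omega

theorem complementBounded {m n s : ℕ} (hs : s ≤ m) : ComplementBounded m n s := by
  have hrow : ∀ n, ComplementBounded m n 0 → ∀ s ≤ m, ComplementBounded m n s := by
    intro n h s hs
    induction s with
    | zero => exact h
    | succ s ih => exact (ih (by omega)).succ_row (by omega)
  refine hrow n ?_ s hs
  induction n with
  | zero =>
    intro T w _ _ _ _
    have : partialCells m 0 0 = ∅ := by
      ext ⟨i, j⟩
      simp [mem_partialCells]
    simp [this]
  | succ n ih => exact (hrow n ih m le_rfl).succ_column

/-- The sequence whose prefix ranks bound the chains of the `(k + 1)`-free sets of edges. -/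
def crossingFreeSequence (k n a : ℕ) : ℕ :=
  -- For 2k ≤ n: first n, …, n-k+1, then the increasing run k+1, …, n-k, then k, …, 1, then zeros.
  -- All ascents lie in the run of length n-2k.
  if k ≤ a ∧ a + k < n then a + 1 else n - a

theorem le_prefixRank_crossingFreeSequence {k n p q r : ℕ} (hp : p ≤ n) (hrp : r ≤ p)
    (hrq : r ≤ n - q) (hrk : r ≤ k + (p - q)) :
    r ≤ prefixRank (crossingFreeSequence k n) p q := by
  induction p generalizing r with
  | zero => omega
  | succ p ih =>
    rw [prefixRank_succ]
    by_cases h : r ≤ p ∧ r ≤ k + (p - q)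
    · exact (ih (by omega) h.1 hrq h.2).trans (Nat.le_add_right _ _)
    · obtain _ | r := r
      · exact Nat.zero_le _
      · have h1 := ih (by omega) (r := r) (by omega) (by omega) (by omega)
        rw [if_pos]
        · omega
        · rw [crossingFreeSequence]
          split_ifs <;> omega

theorem prefixRank_crossingFreeSequence_le (k n p : ℕ) :
    prefixRank (crossingFreeSequence k n) p p ≤ k := by
  rw [prefixRank]
  refine (Finset.card_le_card (t := Finset.range k) fun a ha => ?_).trans (by simp)
  rw [Finset.mem_filter, Finset.mem_range, crossingFreeSequence] at ha
  rw [Finset.mem_range]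
  split_ifs at ha <;> omega

theorem ascentCount_crossingFreeSequence_le (k n N : ℕ) :
    ascentCount (crossingFreeSequence k n) N ≤ Nat.card (KEdge (n - 2 * k)) := by
  classical
  rw [Nat.card_eq_fintype_card, ← Finset.card_univ]
  have key : ∀ ab ∈ (Finset.range N ×ˢ Finset.range N).filter fun ab : ℕ × ℕ =>
      ab.1 < ab.2 ∧ crossingFreeSequence k n ab.1 < crossingFreeSequence k n ab.2,
      k ≤ ab.1 ∧ ab.1 < ab.2 ∧ ab.2 + k < n := by
    rintro ⟨a, b⟩ h
    rw [Finset.mem_filter, crossingFreeSequence, crossingFreeSequence] at h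
    obtain ⟨-, h1, h2⟩ := h
    dsimp only at h1 h2 ⊢
    split_ifs at h2 <;> omega
  rw [ascentCount, ← Fintype.card_coe]
  refine Fintype.card_le_of_injective (fun ab => ⟨(⟨ab.1.1 - k, ?_⟩, ⟨ab.1.2 - k, ?_⟩), ?_⟩) ?_
  · have := key ab ab.2
    omega
  · have := key ab ab.2
    omega
  · have := key ab ab.2
    simp only [Fin.mk_lt_mk]
    omega
  · rintro ⟨ab, hab⟩ ⟨cd, hcd⟩ h
    have h1 := key ab hab
    have h2 := key cd hcd
    simp only [Subtype.mk.injEq, Prod.mk.injEq, Fin.mk.injEq] at h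
    ext <;> dsimp only <;> omega

/-- Dropping the last row costs at most the last cell of the chain. -/
theorem HasChain.strip_rows {T : Set (ℕ × ℕ)} {q r p n d : ℕ} (h : HasChain T q r p n) :
    HasChain T q (r - d) (p - d) n := by
  induction d with
  | zero => exact h
  | succ d ih =>
    rw [Nat.sub_add_eq, Nat.sub_add_eq]
    revert ih
    generalize r - d = r', p - d = p'
    intro ih
    obtain _ | r' := r'
    · trivial
    · obtain ⟨i, hi, j, hj, -, -, hc⟩ := ih
      exact hc.mono subset_rfl (by omega) hj.le

theorem hasChain_of_isMCrossing {n : ℕ} {T : Set (ℕ × ℕ)} {m p q n' : ℕ}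
    {C : Finset (KEdge n)} (hC : IsMCrossing m C)
    (hCT : ∀ e ∈ C, ((e.1.1 : ℕ), (e.1.2 : ℕ)) ∈ T)
    (hb : ∀ e ∈ C, (e.1.1 : ℕ) < p ∧ (e.1.2 : ℕ) < n' ∧ q ≤ e.1.2) : HasChain T q m p n' := by
  classical
  induction m generalizing C p n' with
  | zero => trivial
  | succ m ih =>
    obtain ⟨hcard, hcr⟩ := hC
    have hne : C.Nonempty := Finset.card_pos.1 (by omega)
    obtain ⟨e, he, hmax⟩ := Finset.exists_max_image C (fun e => e.1.1) hne
    obtain ⟨h1, h2, h3⟩ := hb e he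
    refine ⟨e.1.1, h1, e.1.2, h2, h3, hCT e he, ih (C := C.erase e) ⟨?_, ?_⟩ ?_ ?_⟩
    · rw [Finset.card_erase_of_mem he, hcard]
      rfl
    · exact fun f hf g hg => hcr f (Finset.mem_of_mem_erase hf) g (Finset.mem_of_mem_erase hg)
    · exact fun f hf => hCT f (Finset.mem_of_mem_erase hf)
    · intro f hf
      have hfC := Finset.mem_of_mem_erase hf
      have h4 := hmax f hfC
      have h5 := hcr f hfC e he (Finset.ne_of_mem_erase hf)
      have h6 := hb f hfC
      simp only [KEdge.Crosses, Fin.lt_def, Fin.le_def] at h4 h5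
      omega

/-- The cut is made just after the largest first endpoint; mutual crossing puts every second
endpoint beyond it. -/
theorem hasChain_of_isMCrossing_succ {n m : ℕ} {T : Set (ℕ × ℕ)} {C : Finset (KEdge n)}
    (hC : IsMCrossing (m + 1) C) (hCT : ∀ e ∈ C, ((e.1.1 : ℕ), (e.1.2 : ℕ)) ∈ T) :
    ∃ p ≤ n - 1, HasChain T p (m + 1) p n := by
  have hne : C.Nonempty := Finset.card_pos.1 (by rw [hC.1]; omega)
  obtain ⟨e, he, hmax⟩ := Finset.exists_max_image C (fun e => e.1.1) hne
  have hlt : (e.1.1 : ℕ) < e.1.2 := e.2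
  refine ⟨e.1.1 + 1, by omega, hasChain_of_isMCrossing hC hCT fun f hf => ?_⟩
  have h1 := hmax f hf
  have h2 : f ≠ e → f.Crosses e := hC.2 f hf e he
  have h3 : (f.1.1 : ℕ) < f.1.2 := f.2
  rw [Fin.le_def] at h1
  by_cases hfe : f = e
  · subst hfe; omega
  · have := h2 hfe
    simp only [KEdge.Crosses, Fin.lt_def] at this
    omega

/-- A `k`-triangulation of the `n`-gon misses at most as many edges as there are on `n - 2k`
vertices. -/
theorem IsMultitriangulation.card_le {k n : ℕ} {T : Set (KEdge n)}
    (hT : IsMultitriangulation k T) :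
    Nat.card (KEdge n) ≤ T.ncard + Nat.card (KEdge (n - 2 * k)) := by
  classical
  obtain _ | n' := n
  · have : IsEmpty (KEdge 0) := ⟨fun e => e.1.1.elim0⟩
    simp
  let cell : KEdge (n' + 1) → ℕ × ℕ := fun e => (e.1.1, e.1.2)
  have hcell : Function.Injective cell := by
    intro e f h
    simp only [cell, Prod.mk.injEq] at h
    ext <;> omega
  -- All cells on or below the diagonal are put into `S`, so the cells outside `S` are exactly the
  -- missing edges.
  let S : Finset (ℕ × ℕ) := (partialCells (n' + 1) n' (n' + 1)).filter fun c => c.1 < c.2 → c ∈ cell '' T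
  let w := crossingFreeSequence k (n' + 1)
  have hS : ∀ {i j : ℕ}, (i, j) ∈ (S : Set (ℕ × ℕ)) → i < j → (i, j) ∈ cell '' T := by
    intro i j h hij
    rw [Finset.mem_coe, Finset.mem_filter] at h
    exact h.2 hij
  have hw : ∀ q ≤ n', n' + 1 - q ≤ prefixRank w (n' + 1 + 1) q := by
    intro q hq
    refine (le_prefixRank_crossingFreeSequence (k := k) (n := n' + 1) (p := n' + 1) (q := q) le_rfl
      (by omega) (by omega) (by omega)).trans ?_
    rw [prefixRank_succ w (n' + 1)]
    exact Nat.le_add_right _ _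
  have hfree : ∀ q r, HasChain S q r q (n' + 1) → r ≤ k := by
    intro q r hr
    by_contra! hlt
    have h1 : HasChain (cornerExtension 0 T) q r q (n' + 1) := by
      refine hr.of_forall fun i hi j hj hq hij => ?_
      obtain ⟨e, he, heq⟩ := hS hij (by omega)
      exact Or.inl ⟨e, he, by simp [← heq, cell]⟩
    have h2 : HasChain (cornerExtension 0 T) q (k + 1) q (n' + 1) :=
      (h1.strip_rows (d := r - (k + 1))).mono subset_rfl (Nat.sub_le _ _) le_rfl |> fun h => by
        rwa [Nat.sub_sub_self hlt] at h
    obtain ⟨C, hC, hCT, -⟩ := exists_isMCrossing_of_hasChain h2 le_rfl (by omega)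
    exact hT.prop C hC hCT
  have hgood : ChainsBounded (n' + 1) S n' (n' + 1) w := by
    refine ⟨fun p hp q hq r hr => ?_, fun p hp hpm q hq r hr => ?_⟩
    · refine le_prefixRank_crossingFreeSequence hp hr.le_rows hr.le_cols ?_
      rcases Nat.le_total p q with hpq | hpq
      · have := hfree q r (hr.mono subset_rfl hpq le_rfl)
        omega
      -- Dropping the last p - q rows reduces to a block above the diagonal, where chains have
      -- length at most k.
      · have := hfree q _ ((hr.strip_rows (d := p - q)).mono subset_rfl (by omega) le_rfl)
        omega
    · obtain rfl : p = n' + 1 := le_antisymm hpm hp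
      have h1 := hr.le_cols
      have h2 := hw q hq
      omega
  have hmax : ∀ c ∈ partialCells (n' + 1) n' (n' + 1), c ∉ S →
      ¬ ChainsBounded (n' + 1) (insert c (S : Set (ℕ × ℕ))) n' (n' + 1) w := by
    rintro ⟨i, j⟩ hc hcS hb
    have hij : i < j ∧ (i, j) ∉ cell '' T := by
      by_contra h
      refine hcS (Finset.mem_filter.2 ⟨hc, fun h1 => ?_⟩)
      by_contra h2
      exact h ⟨h1, h2⟩
    rw [mem_partialCells] at hc
    let e : KEdge (n' + 1) := ⟨(⟨i, by omega⟩, ⟨j, by omega⟩), by simpa using hij.1⟩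
    have heT : e ∉ T := fun h => hij.2 ⟨e, h, rfl⟩
    -- If `e` could be added within the bounds, a (k+1)-crossing in the enlarged set would give a
    -- chain of length k+1 in a block with p = q, where the bound is k.
    refine heT (hT.le_of_ge (y := insert e T) ?_ (Set.subset_insert _ _) (Set.mem_insert _ _))
    intro C hC hCT
    obtain ⟨p, hp, hch⟩ := hasChain_of_isMCrossing_succ (T := insert (i, j) (S : Set (ℕ × ℕ))) hC (by
      intro f hf
      rcases hCT hf with rfl | hfT
      · exact Set.mem_insert _ _
      · refine Set.mem_insert_of_mem _ (Finset.mem_coe.2 (Finset.mem_filter.2 ⟨?_, fun _ => ?_⟩))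
        · rw [mem_partialCells]
          omega
        · exact ⟨f, hfT, rfl⟩)
    have h1 := hb.1 p (by omega) p (by omega) _ hch
    have h2 : prefixRank w p p ≤ k := prefixRank_crossingFreeSequence_le k (n' + 1) p
    omega
  have key := complementBounded le_rfl S w hw hgood hmax (Finset.filter_subset _ _)
  have hcompl : Tᶜ.ncard ≤ (partialCells (n' + 1) n' (n' + 1) \ S).card := by
    rw [← Set.ncard_coe_finset]
    refine Set.ncard_le_ncard_of_injOn cell ?_ hcell.injOn (Finset.finite_toSet _)
    intro e he
    rw [Finset.mem_coe, Finset.mem_sdiff]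
    have hlt : (e.1.1 : ℕ) < e.1.2 := e.2
    refine ⟨mem_partialCells.2 (by omega), fun h => he ?_⟩
    obtain ⟨f, hf, hfe⟩ := hS h hlt
    rwa [← hcell hfe]
  have h1 := Set.ncard_add_ncard_compl T
  have h2 := ascentCount_crossingFreeSequence_le k (n' + 1) ((n' + 1) + 1 + n')
  have h3 : ascentCount w ((n' + 1) + 1 + n') ≤ _ := h2
  omega

/-! ### The Jacobian criterion in characteristic 0 -/

theorem linearIndependent_row_iff_exists_det_ne_zero {L m σ : Type*} [Field L] [Fintype m]
    [DecidableEq m] [Finite σ] (M : Matrix m σ L) :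
    LinearIndependent L M.row ↔ ∃ g : m → σ, (M.submatrix id g).det ≠ 0 := by
  have := Fintype.ofFinite σ
  constructor
  · intro h
    have hrank : M.rank = Fintype.card m := h.rank_matrix
    have hspan : Submodule.span L (Set.range M.col) = ⊤ := by
      apply Submodule.eq_top_of_finrank_eq
      rw [← Matrix.rank_eq_finrank_span_cols, hrank, Module.finrank_fintype_fun_eq_card]
    obtain ⟨b, hb, hbspan, hli⟩ := exists_linearIndependent L (Set.range M.col)
    let B := Module.Basis.mk hli (by rw [Subtype.range_coe, hbspan, hspan])
    let e := (Pi.basisFun L m).indexEquiv B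
    choose g hg using fun i => hb (e i).2
    refine ⟨g, ?_⟩
    rw [← isUnit_iff_ne_zero, ← Matrix.isUnit_iff_isUnit_det,
      ← Matrix.linearIndependent_cols_iff_isUnit]
    have h2 := hli.comp e e.injective
    convert! h2 using 1
    ext i j
    exact congrFun (hg i) j
  · rintro ⟨g, hg⟩
    have h1 : LinearIndependent L (M.submatrix id g).row :=
      Matrix.linearIndependent_rows_iff_isUnit.2 ((Matrix.isUnit_iff_isUnit_det _).2 hg.isUnit)
    exact LinearIndependent.of_comp (LinearMap.funLeft L L g) h1

section JacobianCriterion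

variable {K σ ι : Type*} [Field K]

theorem MvPolynomial.totalDegree_pderiv_lt (P : MvPolynomial ι K) (i : ι)
    (h : MvPolynomial.pderiv i P ≠ 0) :
    (MvPolynomial.pderiv i P).totalDegree < P.totalDegree := by
  classical
  have key : ∀ m ∈ (MvPolynomial.pderiv i P).support, m.degree + 1 ≤ P.totalDegree := by
    intro m hm
    rw [MvPolynomial.mem_support_iff, MvPolynomial.coeff_pderiv] at hm
    have h1 := MvPolynomial.le_totalDegree
      (MvPolynomial.mem_support_iff.2 (left_ne_zero_of_mul hm))
    change (m + Finsupp.single i 1).degree ≤ _ at h1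
    simpa using h1
  obtain ⟨m, hm⟩ := MvPolynomial.support_nonempty.2 h
  exact (Finset.sup_lt_iff ((Nat.succ_pos _).trans_le (key m hm))).2 key

theorem MvPolynomial.pderiv_aeval [Fintype ι] (f : ι → MvPolynomial σ K) (s : σ)
    (P : MvPolynomial ι K) :
    MvPolynomial.pderiv s (MvPolynomial.aeval f P) =
      ∑ i, MvPolynomial.aeval f (MvPolynomial.pderiv i P) * MvPolynomial.pderiv s (f i) := by
  classical
  induction P using MvPolynomial.induction_on with
  | C a => simp
  | add p q hp hq => simp only [map_add, hp, hq, add_mul, Finset.sum_add_distrib]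
  | mul_X p i hp =>
    simp only [map_mul, MvPolynomial.aeval_X, MvPolynomial.pderiv_mul, hp, map_add, add_mul,
      Finset.sum_add_distrib, Finset.sum_mul, MvPolynomial.pderiv_X]
    congr 1
    · exact Finset.sum_congr rfl fun j _ => by ring
    · rw [Finset.sum_eq_single i] <;> simp +contextual [eq_comm]

variable [CharZero K]

theorem MvPolynomial.eq_C_of_pderiv_eq_zero (P : MvPolynomial ι K)
    (h : ∀ i, MvPolynomial.pderiv i P = 0) : P = MvPolynomial.C (P.coeff 0) := by
  classical
  ext m
  rw [MvPolynomial.coeff_C]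
  split_ifs with hm
  · rw [hm]
  · obtain ⟨i, hi⟩ : ∃ i, m i ≠ 0 := by
      by_contra! hc
      exact hm (Finsupp.ext hc).symm
    have h1 := congrArg (MvPolynomial.coeff (m - Finsupp.single i 1)) (h i)
    rw [MvPolynomial.coeff_pderiv, MvPolynomial.coeff_zero, tsub_add_cancel_of_le
      (Finsupp.single_le_iff.2 (Nat.one_le_iff_ne_zero.2 hi))] at h1
    exact (mul_eq_zero.1 h1).resolve_right (Nat.cast_add_one_ne_zero _)

/-- By the chain rule the values (∂_i P)(f) of a relation P are coefficients of a linear relation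
between the Jacobian rows, so they vanish. Each ∂_i P is then a relation of smaller degree, hence 0
by induction, and P is constant. -/
theorem algebraicIndependent_of_linearIndependent_pderiv [Finite ι] (f : ι → MvPolynomial σ K)
    (h : LinearIndependent (FractionRing (MvPolynomial σ K)) fun i s =>
      algebraMap _ (FractionRing (MvPolynomial σ K)) (MvPolynomial.pderiv s (f i))) :
    AlgebraicIndependent K f := by
  have := Fintype.ofFinite ι
  rw [algebraicIndependent_iff]
  intro P
  induction hd : P.totalDegree using Nat.strong_induction_on generalizing P with
  | _ d ih =>
  intro hP
  have h1 : ∀ i, MvPolynomial.aeval f (MvPolynomial.pderiv i P) = 0 := by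
    intro i
    have h2 := Fintype.linearIndependent_iff.1 h
      (fun i => algebraMap _ _ (MvPolynomial.aeval f (MvPolynomial.pderiv i P))) (by
        funext s
        have := MvPolynomial.pderiv_aeval f s P
        rw [hP, map_zero] at this
        simp only [Finset.sum_apply, Pi.smul_apply, smul_eq_mul, Pi.zero_apply, ← map_mul,
          ← map_sum]
        rw [← this, map_zero]) i
    exact (map_eq_zero_iff _ (IsFractionRing.injective _ _)).1 h2
  have h2 := MvPolynomial.eq_C_of_pderiv_eq_zero P fun i => by
    by_contra hne
    exact hne (ih _ (hd ▸ MvPolynomial.totalDegree_pderiv_lt P i hne) _ rfl (h1 i))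
  rw [h2, MvPolynomial.aeval_C, MvPolynomial.algebraMap_eq, MvPolynomial.C_eq_zero] at hP
  rw [h2, hP, map_zero]

open KaehlerDifferential in
-- In characteristic 0, L is formally smooth over the fraction field of A = K[x], hence over A. So
-- the first cotangent homology of L over A vanishes and L ⊗ Ω_{A/K} → Ω_{L/K} is injective; it
-- sends the basis of differentials of the variables to the D(x_i).
theorem linearIndependent_D_of_algebraicIndependent {L : Type*} [Field L] [Algebra K L]
    [Algebra.EssFiniteType K L] {x : ι → L} (h : AlgebraicIndependent K x) :
    LinearIndependent L fun i => D K L (x i) := by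
  let A := MvPolynomial ι K
  let φ : A →ₐ[K] L := MvPolynomial.aeval x
  let _ : Algebra A L := φ.toAlgebra
  have _ : IsScalarTower K A L := IsScalarTower.of_algebraMap_eq' φ.comp_algebraMap.symm
  have hφ : Function.Injective (algebraMap A L) := h
  have _ : FaithfulSMul A L := (faithfulSMul_iff_algebraMap_injective A L).2 hφ
  let _ : Algebra (FractionRing A) L := FractionRing.liftAlgebra A L
  have _ : IsScalarTower A (FractionRing A) L := FractionRing.isScalarTower_liftAlgebra A L
  have _ : IsScalarTower K (FractionRing A) L := .to₁₃₄ K A (FractionRing A) L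
  have _ : CharZero (FractionRing A) :=
    charZero_of_injective_algebraMap (R := K) (algebraMap K _).injective
  have _ : Algebra.EssFiniteType (FractionRing A) L := .of_comp K (FractionRing A) L
  have _ : Algebra.FormallySmooth A (FractionRing A) := .of_isLocalization (nonZeroDivisors A)
  have _ : Algebra.FormallySmooth (FractionRing A) L := inferInstance
  have _ : Algebra.FormallySmooth A L := .comp A (FractionRing A) L
  have hinj : Function.Injective (mapBaseChange K A L) := by
    rw [injective_iff_map_eq_zero]
    intro x hx
    obtain ⟨x, rfl⟩ := (Algebra.H1Cotangent.exact_δ_mapBaseChange K A L x).mp hx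
    rw [Subsingleton.elim x 0, map_zero]
  have h1 := ((Algebra.TensorProduct.basis L (mvPolynomialBasis K ι)).linearIndependent).map_injOn
    (mapBaseChange K A L) hinj.injOn
  convert! h1 using 1
  funext i
  rw [Function.comp_apply, Algebra.TensorProduct.basis_apply, mvPolynomialBasis_apply]
  refine Eq.trans ?_ (mapBaseChange_tmul K A L _ _).symm
  rw [one_smul, map_D]
  congr 1
  exact (MvPolynomial.aeval_X x i).symm

open KaehlerDifferential in
-- The linear map that sends the s-th unit vector to D(X_s) takes the Jacobian row of `f i` to D(f
-- i).
theorem linearIndependent_pderiv_of_algebraicIndependent [Finite σ] (f : ι → MvPolynomial σ K)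
    (h : AlgebraicIndependent K f) :
    LinearIndependent (FractionRing (MvPolynomial σ K)) fun i s =>
      algebraMap _ (FractionRing (MvPolynomial σ K)) (MvPolynomial.pderiv s (f i)) := by
  have := Fintype.ofFinite σ
  have _ : Algebra.EssFiniteType K (FractionRing (MvPolynomial σ K)) :=
    inferInstanceAs (Algebra.EssFiniteType K (Localization (nonZeroDivisors (MvPolynomial σ K))))
  have hD := linearIndependent_D_of_algebraicIndependent (h.map' (f := IsScalarTower.toAlgHom K
    (MvPolynomial σ K) (FractionRing (MvPolynomial σ K))) (IsFractionRing.injective _ _))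
  refine LinearIndependent.of_comp (Fintype.linearCombination (FractionRing (MvPolynomial σ K))
    fun s => D K (FractionRing (MvPolynomial σ K)) (algebraMap (MvPolynomial σ K) _ (MvPolynomial.X s))) ?_
  convert! hD using 1
  funext i
  have h2 := congrArg (KaehlerDifferential.map K K (MvPolynomial σ K)
    (FractionRing (MvPolynomial σ K))) ((mvPolynomialBasis K σ).sum_repr (D K _ (f i)))
  rw [map_D] at h2
  simp only [Function.comp_apply, IsScalarTower.coe_toAlgHom']
  rw [← h2]
  simp only [Fintype.linearCombination_apply, map_sum, map_smul, mvPolynomialBasis_apply,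
    mvPolynomialBasis_repr_apply, map_D, algebraMap_smul]

end JacobianCriterion

theorem algebraicIndependent_iff_exists_det_pderiv_ne_zero {K σ ι : Type*} [Field K] [CharZero K]
    [Finite σ] [Fintype ι] [DecidableEq ι] (f : ι → MvPolynomial σ K) :
    AlgebraicIndependent K f ↔ ∃ g : ι → σ,
      (Matrix.of fun i j => MvPolynomial.pderiv (g j) (f i)).det ≠ 0 := by
  have h1 : AlgebraicIndependent K f ↔ LinearIndependent (FractionRing (MvPolynomial σ K))
      (Matrix.of fun i s => algebraMap _ (FractionRing (MvPolynomial σ K))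
        (MvPolynomial.pderiv s (f i))).row :=
    ⟨linearIndependent_pderiv_of_algebraicIndependent f,
      algebraicIndependent_of_linearIndependent_pderiv f⟩
  rw [h1, linearIndependent_row_iff_exists_det_ne_zero]
  refine exists_congr fun g => ?_
  rw [← map_ne_zero_iff (algebraMap (MvPolynomial σ K) (FractionRing (MvPolynomial σ K)))
    (IsFractionRing.injective _ _), RingHom.map_det]
  rfl

/-! ### The Jacobian of T and the generic hyperconnectivity matroid -/

theorem map_pairParamPoly {R S : Type*} [CommRing R] [CommRing S] (φ : R →+* S) (k n : ℕ)
    (e : KEdge n) : MvPolynomial.map φ (pairParamPoly R k n e) = pairParamPoly S k n e := by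
  simp [pairParamPoly]

/-- The right-hand side does not involve `K`, so the criterion transfers between fields of
characteristic 0. -/
theorem algebraicIndepOn_pairParamPoly_iff_exists_det_int (K : Type*) [Field K] [CharZero K]
    {k n : ℕ} (S : Set (KEdge n)) [Fintype S] [DecidableEq S] :
    AlgebraicIndepOn K (pairParamPoly K k n) S ↔ ∃ g : S → PairIndex k n,
      (Matrix.of fun i j : S => MvPolynomial.pderiv (g j) (pairParamPoly ℤ k n i)).det ≠ 0 := by
  refine (algebraicIndependent_iff_exists_det_pderiv_ne_zero _).trans (exists_congr fun g => ?_)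
  rw [← map_ne_zero_iff (MvPolynomial.map (Int.castRingHom K))
    (MvPolynomial.map_injective _ (RingHom.injective_int _)), RingHom.map_det]
  refine not_congr (Eq.congr_left (congrArg Matrix.det ?_))
  ext1 i j
  simp [← MvPolynomial.pderiv_map, map_pairParamPoly]

theorem algebraicIndepOn_pairParamPoly_real_iff {k n : ℕ} (S : Set (KEdge n)) :
    AlgebraicIndepOn ℝ (pairParamPoly ℝ k n) S ↔
      ∃ x : PairIndex k n → ℝ, LinearIndepOn ℝ (pairParamJacobian x).row S := by
  classical
  have := Fintype.ofFinite S
  have h1 (x : PairIndex k n → ℝ) : LinearIndepOn ℝ (pairParamJacobian x).row S ↔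
      ∃ g : S → PairIndex k n, MvPolynomial.eval x (Matrix.of fun i j : S =>
        MvPolynomial.pderiv (g j) (pairParamPoly ℝ k n i)).det ≠ 0 := by
    refine (linearIndependent_row_iff_exists_det_ne_zero
      ((pairParamJacobian x).submatrix (Subtype.val : S → _) id)).trans (exists_congr fun g => ?_)
    rw [RingHom.map_det]
    rfl
  refine (algebraicIndependent_iff_exists_det_pderiv_ne_zero _).trans ?_
  simp only [h1]
  rw [exists_comm]
  refine exists_congr fun g => ?_
  rw [Ne, MvPolynomial.funext_iff, not_forall]
  simp

theorem pairParamJacobian_reindex {K : Type*} [CommRing K] {k n : ℕ} (x : PairIndex k n → K) :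
    (pairParamJacobian x).reindex (Equiv.refl _) (pairColumns k n) =
      hyperconnectivityMatrix (pairConfiguration x) := by
  ext e c
  obtain ⟨s, rfl⟩ := (pairColumns k n).surjective c
  have hne := e.2.ne
  rw [Matrix.reindex_apply, Matrix.submatrix_apply, Equiv.symm_apply_apply]
  obtain ⟨l, i⟩ | ⟨l, i⟩ := s
  · simp only [pairParamJacobian, pairParamPoly, pairColumns, hyperconnectivityMatrix,
      pairConfiguration, Matrix.of_apply, map_sum, map_sub, MvPolynomial.pderiv_mul, map_add,
      map_mul, MvPolynomial.eval_X, MvPolynomial.pderiv_X, Pi.single_apply, Equiv.coe_fn_mk,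
      Equiv.refl_symm, Equiv.coe_refl, id]
    have h2 : (2 * l.1) % 2 = 0 := by omega
    have h3 : (2 * l.1) / 2 = l.1 := by omega
    rw [Finset.sum_eq_single l]
    · simp only [h2, h3, reduceIte, reduceCtorEq, Sum.inl.injEq, Prod.mk.injEq, true_and]
      split_ifs <;> grind
    · intro b _ hb
      simp [hb]
    · simp
  · simp only [pairParamJacobian, pairParamPoly, pairColumns, hyperconnectivityMatrix,
      pairConfiguration, Matrix.of_apply, map_sum, map_sub, MvPolynomial.pderiv_mul, map_add,
      map_mul, MvPolynomial.eval_X, MvPolynomial.pderiv_X, Pi.single_apply, Equiv.coe_fn_mk,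
      Equiv.refl_symm, Equiv.coe_refl, id]
    have h2 : ¬ (2 * l.1 + 1) % 2 = 0 := by omega
    have h3 : (2 * l.1 + 1) / 2 = l.1 := by omega
    rw [Finset.sum_eq_single l]
    · simp only [h2, h3, reduceIte, reduceCtorEq, Sum.inr.injEq, Prod.mk.injEq, true_and]
      split_ifs <;> grind
    · intro b _ hb
      simp [hb]
    · simp

theorem pairConfiguration_surjective {K : Type*} [CommRing K] {k n : ℕ} :
    Function.Surjective (pairConfiguration : (PairIndex k n → K) → Fin n → Fin (2 * k) → K) := by
  intro p
  refine ⟨Sum.elim (fun li => -p li.2 ⟨2 * li.1 + 1, by omega⟩)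
    (fun li => p li.2 ⟨2 * li.1, by omega⟩), ?_⟩
  funext i c
  simp only [pairConfiguration, Sum.elim_inl, Sum.elim_inr, neg_neg]
  split_ifs with h <;> congr 1 <;> ext <;> simp only <;> omega

theorem linearIndepOn_row_reindex_iff {R m N N' : Type*} [CommRing R] (M : Matrix m N R)
    (e : N ≃ N') (S : Set m) :
    LinearIndepOn R (M.reindex (Equiv.refl m) e).row S ↔ LinearIndepOn R M.row S :=
  (LinearEquiv.funCongrLeft R R e.symm).toLinearMap.linearIndependent_iff
    (LinearEquiv.ker _)

theorem genericHyperconnectivityMatroid_indep_iff {d n : ℕ} (S : Set (KEdge n)) :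
    (genericHyperconnectivityMatroid d n).Indep S ↔
      ∃ p : Fin n → Fin d → ℝ, LinearIndepOn ℝ (hyperconnectivityMatrix p).row S :=
  Iff.rfl

theorem genericHyperconnectivityMatroid_indep_iff_algebraicIndepOn (K : Type*) [Field K]
    [CharZero K] {k n : ℕ} (S : Set (KEdge n)) :
    (genericHyperconnectivityMatroid (2 * k) n).Indep S ↔
      AlgebraicIndepOn K (pairParamPoly K k n) S := by
  classical
  have := Fintype.ofFinite S
  rw [algebraicIndepOn_pairParamPoly_iff_exists_det_int,
    ← algebraicIndepOn_pairParamPoly_iff_exists_det_int ℝ, algebraicIndepOn_pairParamPoly_real_iff,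
    genericHyperconnectivityMatroid_indep_iff, pairConfiguration_surjective.exists]
  simp only [← pairParamJacobian_reindex, linearIndepOn_row_reindex_iff]

/-! ### Genericity on an open dense set -/

theorem isOpen_setOf_linearIndepOn_hyperconnectivityMatrix {d n : ℕ} (S : Set (KEdge n)) :
    IsOpen {p : Fin n → Fin d → ℝ | LinearIndepOn ℝ (hyperconnectivityMatrix p).row S} := by
  refine isOpen_setOfPred_linearIndependent.preimage (f := fun p : Fin n → Fin d → ℝ =>
    fun e : S => (hyperconnectivityMatrix p).row e) ?_
  refine continuous_pi fun e => continuous_pi fun c => ?_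
  simp only [hyperconnectivityMatrix, Matrix.row, Matrix.of_apply]
  split_ifs <;> fun_prop

/-- On the line from any `p` to a witness `q`, independence fails only at the finitely many roots of
a nonzero polynomial, so `p` is a limit of good points. -/
theorem dense_setOf_linearIndepOn_hyperconnectivityMatrix {d n : ℕ} {S : Set (KEdge n)}
    (hS : (genericHyperconnectivityMatroid d n).Indep S) :
    Dense {p : Fin n → Fin d → ℝ | LinearIndepOn ℝ (hyperconnectivityMatrix p).row S} := by
  obtain ⟨q, hq⟩ := (genericHyperconnectivityMatroid_indep_iff S).1 hS
  intro p
  obtain ⟨g, hg⟩ := exists_polynomial_indep p q S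
  have hg0 : g ≠ 0 := by
    rintro rfl
    exact (hg 1).2 (by simpa using hq) (by simp)
  have hd : Dense {t : ℝ | g.eval t ≠ 0} := by
    have h1 : {t : ℝ | g.eval t ≠ 0} = {t | t ∈ (g.roots.toFinset : Set ℝ)}ᶜ := by
      ext t
      simp [hg0]
    rw [h1]
    exact g.roots.toFinset.finite_toSet.countable.dense_compl ℝ
  have hc : Continuous fun t : ℝ => p + t • (q - p) := by fun_prop
  have := map_mem_closure (t := {p | LinearIndepOn ℝ (hyperconnectivityMatrix p).row S}) hc (hd 0)
    fun t ht => (hg t).1 ht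
  simpa using this

theorem exists_isOpen_dense_hyperconnectivityMatroid_eq (d n : ℕ) :
    ∃ U : Set (Fin n → Fin d → ℝ), IsOpen U ∧ Dense U ∧
      ∀ p ∈ U, hyperconnectivityMatroid p = genericHyperconnectivityMatroid d n := by
  let I := {S : Set (KEdge n) // (genericHyperconnectivityMatroid d n).Indep S}
  refine ⟨⋂ S : I, {p | LinearIndepOn ℝ (hyperconnectivityMatrix p).row S.1},
    isOpen_iInter_of_finite fun S => isOpen_setOf_linearIndepOn_hyperconnectivityMatrix _,
    dense_iInter_of_isOpen (fun S => isOpen_setOf_linearIndepOn_hyperconnectivityMatrix _)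
      fun S => dense_setOf_linearIndepOn_hyperconnectivityMatrix S.2, fun p hp => ?_⟩
  refine Matroid.ext_indep rfl fun S _ => ⟨fun h => ⟨p, h⟩, fun h => ?_⟩
  exact Set.mem_iInter.1 hp ⟨S, h⟩

/-! ### Stresses and the upper bound on the rank -/

section Stresses

open Matrix Module

variable {K : Type*} [Field K]

/-- The antisymmetric matrix with prescribed entries above the diagonal. -/
def antisymmMatrix {n : ℕ} : (KEdge n → K) →ₗ[K] Matrix (Fin n) (Fin n) K where
  toFun a := Matrix.of fun i j =>
    if h : i < j then a ⟨(i, j), h⟩ else if h : j < i then -a ⟨(j, i), h⟩ else 0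
  map_add' a b := by
    ext i j
    simp only [Matrix.of_apply, Matrix.add_apply, Pi.add_apply]
    split_ifs <;> simp [add_comm]
  map_smul' c a := by
    ext i j
    simp only [Matrix.of_apply, Matrix.smul_apply, Pi.smul_apply, RingHom.id_apply]
    split_ifs <;> simp

theorem antisymmMatrix_apply {n : ℕ} (a : KEdge n → K) (i j : Fin n) :
    antisymmMatrix a i j =
      if h : i < j then a ⟨(i, j), h⟩ else if h : j < i then -a ⟨(j, i), h⟩ else 0 := rfl

theorem antisymmMatrix_apply_edge {n : ℕ} (a : KEdge n → K) (e : KEdge n) :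
    antisymmMatrix a e.1.1 e.1.2 = a e := by
  rw [antisymmMatrix_apply, dif_pos e.2]

theorem antisymmMatrix_transpose {n : ℕ} (a : KEdge n → K) :
    (antisymmMatrix a)ᵀ = -antisymmMatrix a := by
  ext i j
  rw [transpose_apply, neg_apply, antisymmMatrix_apply, antisymmMatrix_apply]
  split_ifs with h1 h2 h3
  · exact absurd h1 h2.asymm
  all_goals simp

theorem antisymmMatrix_injective {n : ℕ} :
    Function.Injective (antisymmMatrix : (KEdge n → K) →ₗ[K] _) := by
  intro a b h
  funext e
  rw [← antisymmMatrix_apply_edge a, h, antisymmMatrix_apply_edge]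

theorem antisymmMatrix_of_transpose_eq_neg [CharZero K] {n : ℕ} {A : Matrix (Fin n) (Fin n) K}
    (hA : Aᵀ = -A) : antisymmMatrix (fun e : KEdge n => A e.1.1 e.1.2) = A := by
  ext i j
  have h (i j) : A j i = -A i j := congrFun (congrFun hA i) j
  rw [antisymmMatrix_apply]
  split_ifs with h1 h2
  · rfl
  · exact (h j i).symm
  · have : i = j := le_antisymm (not_lt.1 h2) (not_lt.1 h1)
    subst this
    exact (self_eq_neg.1 (h i i)).symm

theorem sum_kEdge {M : Type*} [AddCommMonoid M] {n : ℕ} (f : KEdge n → M) :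
    ∑ e, f e = ∑ i, ∑ j, if h : i < j then f ⟨(i, j), h⟩ else 0 := by
  classical
  rw [← Fintype.sum_prod_type' (f := fun i j => if h : i < j then f ⟨(i, j), h⟩ else 0)]
  rw [← Finset.sum_subset (Finset.subset_univ (Finset.univ.filter
    fun e : Fin n × Fin n => e.1 < e.2))]
  · rw [Finset.sum_subtype (p := fun e : Fin n × Fin n => e.1 < e.2) _ (by simp)]
    exact Finset.sum_congr rfl fun e _ => by rw [dif_pos e.2]
  · intro e _ he
    rw [dif_neg (by simpa using he)]

/-- The linear relations between the rows are thereby the antisymmetric matrices A with A P = 0. -/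
theorem vecMul_hyperconnectivityMatrix {d n : ℕ} (p : Fin n → Fin d → K) (a : KEdge n → K)
    (v : Fin n) (c : Fin d) :
    (a ᵥ* hyperconnectivityMatrix p) (v, c) = (antisymmMatrix a * Matrix.of p) v c := by
  have h1 (e : KEdge n) : a e * hyperconnectivityMatrix p e (v, c) =
      (if v = e.1.1 then a e * p e.1.2 c else 0) +
        (if v = e.1.2 then -a e * p e.1.1 c else 0) := by
    have := e.2.ne
    simp only [hyperconnectivityMatrix, Matrix.of_apply]
    split_ifs <;> simp_all
  simp only [vecMul, dotProduct, h1, Finset.sum_add_distrib, sum_kEdge, Matrix.mul_apply,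
    Matrix.of_apply]
  have h2 (i : Fin n) : (∑ j, if h : i < j then (if v = i then a ⟨(i, j), h⟩ * p j c else 0)
      else 0) = if v = i then ∑ j, (if h : i < j then a ⟨(i, j), h⟩ * p j c else 0) else 0 := by
    split_ifs <;> simp
  have h3 (i : Fin n) : (∑ j, if h : i < j then (if v = j then -a ⟨(i, j), h⟩ * p i c else 0)
      else 0) = if h : i < v then -a ⟨(i, v), h⟩ * p i c else 0 := by
    rw [Finset.sum_eq_single v]
    · simp
    · intro b _ hb
      simp [hb.symm]
    · simp
  simp only [h2, h3, Finset.sum_ite_eq, Finset.mem_univ, if_true]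
  rw [← Finset.sum_add_distrib]
  refine Finset.sum_congr rfl fun j _ => ?_
  rw [antisymmMatrix_apply]
  split_ifs with h2 h3
  · exact absurd h2 h3.asymm
  all_goals simp

/-- The left kernel of P has dimension at least n-d and supplies the rows of X. The right inverse Y
will recover S from XᵀSX. -/
theorem exists_mul_eq_zero_and_mul_eq_one {n d : ℕ} (P : Matrix (Fin n) (Fin d) K) :
    ∃ (X : Matrix (Fin (n - d)) (Fin n) K) (Y : Matrix (Fin n) (Fin (n - d)) K),
      X * P = 0 ∧ X * Y = 1 := by
  have h1 : n - d ≤ finrank K (LinearMap.ker P.vecMulLinear) := by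
    have h2 := LinearMap.finrank_range_add_finrank_ker P.vecMulLinear
    have h3 := Submodule.finrank_le (LinearMap.range P.vecMulLinear)
    rw [finrank_fintype_fun_eq_card, Fintype.card_fin] at h2 h3
    omega
  obtain ⟨f, hf⟩ := exists_linearIndependent_of_le_finrank h1
  let X : Matrix (Fin (n - d)) (Fin n) K := Matrix.of fun i => (f i : Fin n → K)
  have hX : LinearIndependent K X.row := hf.map' (Submodule.subtype _) (Submodule.ker_subtype _)
  have h2 : Function.Surjective X.mulVec := by
    rw [← Matrix.coe_mulVecLin, ← LinearMap.range_eq_top]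
    apply Submodule.eq_top_of_finrank_eq
    exact hX.rank_matrix.trans (finrank_fintype_fun_eq_card K).symm
  obtain ⟨Y, hY⟩ := mulVec_surjective_iff_exists_right_inverse.1 h2
  refine ⟨X, Y, ?_, hY⟩
  ext i j
  exact congrFun (LinearMap.mem_ker.1 (f i).2) j

/-- The matrices XᵀSX, with S antisymmetric of size n-d, annihilate P and depend injectively on S.
This bounds the dimension of the relations from below. -/
theorem ncard_add_card_kEdge_le_of_linearIndepOn [CharZero K] {d n : ℕ} (p : Fin n → Fin d → K)
    {T : Set (KEdge n)} (hT : LinearIndepOn K (hyperconnectivityMatrix p).row T) :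
    T.ncard + Nat.card (KEdge (n - d)) ≤ Nat.card (KEdge n) := by
  classical
  have := Fintype.ofFinite T
  let φ := (hyperconnectivityMatrix p).vecMulLinear
  have h1 : T.ncard ≤ finrank K (LinearMap.range φ) := by
    rw [Set.ncard_eq_toFinset_card', Set.toFinset_card, ← finrank_span_eq_card hT]
    apply Submodule.finrank_mono
    rw [Submodule.span_le]
    rintro _ ⟨e, rfl⟩
    exact ⟨Pi.single e.1 1, by simp [φ]⟩
  have h2 : Nat.card (KEdge (n - d)) ≤ finrank K (LinearMap.ker φ) := by
    obtain ⟨X, Y, hXP, hXY⟩ := exists_mul_eq_zero_and_mul_eq_one (Matrix.of p)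
    let θ : (KEdge (n - d) → K) →ₗ[K] (KEdge n → K) :=
      { toFun := fun S e => (Xᵀ * antisymmMatrix S * X) e.1.1 e.1.2
        map_add' := fun S S' => by
          funext e
          simp [Matrix.mul_add, Matrix.add_mul]
        map_smul' := fun c S => by
          funext e
          simp }
    have hθ (S) : antisymmMatrix (θ S) = Xᵀ * antisymmMatrix S * X := by
      refine antisymmMatrix_of_transpose_eq_neg (A := Xᵀ * antisymmMatrix S * X) ?_
      simp [Matrix.transpose_mul, antisymmMatrix_transpose, Matrix.mul_assoc]
    have hker (S) : θ S ∈ LinearMap.ker φ := by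
      rw [LinearMap.mem_ker]
      funext ⟨v, c⟩
      refine (vecMul_hyperconnectivityMatrix p _ v c).trans ?_
      rw [hθ, Matrix.mul_assoc, hXP, Matrix.mul_zero]
      rfl
    have hinj : Function.Injective (θ.codRestrict _ hker) := by
      intro S S' h
      have h3 : antisymmMatrix (θ S) = antisymmMatrix (θ S') :=
        congrArg antisymmMatrix (congrArg Subtype.val h)
      have h4 (S) : Yᵀ * antisymmMatrix (θ S) * Y = antisymmMatrix S := by
        have hYX : Yᵀ * Xᵀ = 1 := by rw [← Matrix.transpose_mul, hXY, Matrix.transpose_one]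
        rw [hθ, Matrix.mul_assoc, Matrix.mul_assoc, hXY, Matrix.mul_one, ← Matrix.mul_assoc, hYX,
          Matrix.one_mul]
      exact antisymmMatrix_injective (by rw [← h4, h3, h4])
    have h3 := LinearMap.finrank_le_finrank_of_injective hinj
    rwa [finrank_fintype_fun_eq_card, ← Nat.card_eq_fintype_card] at h3
  have h3 := LinearMap.finrank_range_add_finrank_ker φ
  rw [finrank_fintype_fun_eq_card, ← Nat.card_eq_fintype_card] at h3
  omega

end Stresses

/-- The lower bound on |T| meets the upper bound on the size of any independent set containing T. -/
theorem IsMultitriangulation.isBase {k n : ℕ} {T : Set (KEdge n)} (hT : IsMultitriangulation k T) :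
    (genericHyperconnectivityMatroid (2 * k) n).IsBase T := by
  have hind : (genericHyperconnectivityMatroid (2 * k) n).Indep T :=
    (genericHyperconnectivityMatroid_indep_iff_algebraicIndepOn ℚ T).2
      (algebraicIndepOn_pairParamPoly_of_isCrossingFree ℚ hT.prop)
  rw [Matroid.isBase_iff_maximal_indep]
  refine ⟨hind, fun T' hT' hTT' => ?_⟩
  obtain ⟨p, hp⟩ := (genericHyperconnectivityMatroid_indep_iff T').1 hT'
  have h1 := ncard_add_card_kEdge_le_of_linearIndepOn p hp
  have h2 := hT.card_le
  exact (Set.eq_of_subset_of_ncard_le hTT' (by omega)).ge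

/-! ### Pfaffians as coefficients of powers of a bivector -/

theorem sum_pow_eq_factorial_smul_sum_powersetCard {α R : Type*} [CommRing R] (s : Finset α)
    (z : α → R) (hz : ∀ i ∈ s, z i * z i = 0) (m : ℕ) :
    (∑ i ∈ s, z i) ^ m = m.factorial • ∑ E ∈ s.powersetCard m, ∏ i ∈ E, z i := by
  classical
  induction s using Finset.induction_on generalizing m with
  | empty =>
    cases m with
    | zero => simp
    | succ m => simp [Finset.powersetCard_eq_empty.2 (Finset.card_empty.trans_lt m.succ_pos)]
  | insert a s ha ih =>
    have ih := ih fun i hi => hz i (Finset.mem_insert_of_mem hi)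
    have hza := hz a (Finset.mem_insert_self a s)
    have hpow (S : R) (m : ℕ) : (z a + S) ^ (m + 1) = S ^ (m + 1) + (m + 1) * z a * S ^ m := by
      induction m with
      | zero => ring
      | succ m ihm =>
        rw [pow_succ, ihm]
        push_cast
        linear_combination ((m : R) + 1) * S ^ m * hza
    cases m with
    | zero => simp
    | succ m =>
      rw [Finset.sum_insert ha, hpow, ih, ih, Finset.powersetCard_succ_insert ha,
        Finset.sum_union, Finset.sum_image, smul_add, Nat.factorial_succ]
      · congr 1
        have h1 : ∑ E ∈ s.powersetCard m, ∏ i ∈ insert a E, z i =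
            z a * ∑ E ∈ s.powersetCard m, ∏ i ∈ E, z i := by
          rw [Finset.mul_sum]
          refine Finset.sum_congr rfl fun E hE => ?_
          rw [Finset.prod_insert fun h => ha ((Finset.mem_powersetCard.1 hE).1 h)]
        rw [h1, mul_smul, nsmul_eq_mul, nsmul_eq_mul, nsmul_eq_mul]
        push_cast
        ring
      · intro E hE F hF h
        have h1 (E) (hE : E ∈ s.powersetCard m) : a ∉ E :=
          fun h => ha ((Finset.mem_powersetCard.1 hE).1 h)
        rw [← Finset.erase_insert (h1 E hE), h, Finset.erase_insert (h1 F hF)]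
      · rw [Finset.disjoint_left]
        intro E hE hE'
        obtain ⟨F, -, rfl⟩ := Finset.mem_image.1 hE'
        exact ha ((Finset.mem_powersetCard.1 hE).1 (Finset.mem_insert_self a F))

section Wedge

open ExteriorAlgebra

variable {K M : Type*} [CommRing K] [AddCommGroup M] [Module K M]

theorem ExteriorAlgebra.ι_mul_ι_swap (u v : M) : ι K u * ι K v = -(ι K v * ι K u) :=
  eq_neg_of_add_eq_zero_left (ι_add_mul_swap u v)

/-- Moving a vector past two others changes the sign twice. Centrality allows powers of bivectors to
be expanded in a commutative ring. -/
theorem ExteriorAlgebra.ι_mul_ι_mem_center (u v : M) :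
    ι K u * ι K v ∈ Subalgebra.center K (ExteriorAlgebra K M) := by
  rw [Subalgebra.mem_center_iff]
  intro x
  induction x using ExteriorAlgebra.induction with
  | algebraMap r => exact Algebra.commutes r _
  | ι w =>
    rw [← mul_assoc, ι_mul_ι_swap w u, neg_mul, mul_assoc, ι_mul_ι_swap w v, mul_neg, neg_neg,
      mul_assoc]
  | mul a b ha hb => rw [mul_assoc, hb, ← mul_assoc, ha, mul_assoc]
  | add a b ha hb => rw [add_mul, ha, hb, mul_add]

/-- The product of two vectors in the exterior algebra, as a central element. -/
noncomputable def centralWedge : M →ₗ[K] M →ₗ[K] Subalgebra.center K (ExteriorAlgebra K M) :=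
  LinearMap.mk₂ K (fun u v => ⟨ι K u * ι K v, ι_mul_ι_mem_center u v⟩)
    (fun u u' v => Subtype.ext (by simp [add_mul]))
    (fun c u v => Subtype.ext (by simp))
    (fun u v v' => Subtype.ext (by simp [mul_add]))
    (fun c u v => Subtype.ext (by simp))

theorem coe_centralWedge (u v : M) :
    (centralWedge u v : Subalgebra.center K (ExteriorAlgebra K M)).1 = ι K u * ι K v := rfl

theorem centralWedge_self (u : M) :
    (centralWedge u u : Subalgebra.center K (ExteriorAlgebra K M)) = 0 :=
  Subtype.ext (ι_sq_zero u)

theorem ExteriorAlgebra.ι_mul_ι_mul_ι_self (u v : M) : ι K u * ι K v * ι K u = 0 := by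
  rw [ι_mul_ι_swap, neg_mul, mul_assoc, ι_sq_zero, mul_zero, neg_zero]

theorem centralWedge_mul_of_mem {u v u' v' : M} (h : u = u' ∨ u = v' ∨ v = u' ∨ v = v') :
    (centralWedge u v * centralWedge u' v' : Subalgebra.center K (ExteriorAlgebra K M)) = 0 := by
  refine Subtype.ext ?_
  change ι K u * ι K v * (ι K u' * ι K v') = 0
  obtain rfl | rfl | rfl | rfl := h
  · rw [← mul_assoc, ι_mul_ι_mul_ι_self, zero_mul]
  · rw [ι_mul_ι_swap u', mul_neg, ← mul_assoc, ι_mul_ι_mul_ι_self, zero_mul, neg_zero]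
  · rw [mul_assoc, ← mul_assoc (ι K v), ι_sq_zero, zero_mul, mul_zero]
  · rw [mul_assoc, ← mul_assoc (ι K v), ι_mul_ι_mul_ι_self, mul_zero]

variable {I : Type*} [LinearOrder I]

/-- The product in increasing order of the vectors with index in `U`. -/
noncomputable def wedgeMonomial (K : Type*) {M : Type*} [CommRing K] [AddCommGroup M] [Module K M]
    (v : I → M) (U : Finset I) : ExteriorAlgebra K M :=
  (U.sort.map fun i => ι K (v i)).prod

theorem wedgeMonomial_insert_of_lt (v : I → M) {a : I} {U : Finset I} (h : ∀ u ∈ U, a < u) :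
    wedgeMonomial K v (insert a U) = ι K (v a) * wedgeMonomial K v U := by
  rw [wedgeMonomial, Finset.sort_insert (h₁ := fun b hb => (h b hb).le) (h₂ := fun ha => (h a ha).false),
    List.map_cons, List.prod_cons, wedgeMonomial]

theorem ι_mul_wedgeMonomial (v : I → M) (j : I) (U : Finset I) (hj : j ∉ U) :
    ι K (v j) * wedgeMonomial K v U =
      (-1) ^ (U.filter (· < j)).card * wedgeMonomial K v (insert j U) := by
  induction U using Finset.induction_on_min with
  | empty => rw [wedgeMonomial_insert_of_lt v (by simp)]; simp
  | insert a s ha ih =>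
    have has : a ∉ s := fun h => (ha a h).false
    rw [Finset.mem_insert, not_or] at hj
    obtain h | h := lt_or_gt_of_ne hj.1
    · have h1 : ∀ u ∈ insert a s, j < u := by
        intro u hu
        obtain rfl | hu := Finset.mem_insert.1 hu
        · exact h
        · exact h.trans (ha u hu)
      rw [Finset.filter_false_of_mem fun u hu => (h1 u hu).not_gt, Finset.card_empty, pow_zero,
        one_mul, wedgeMonomial_insert_of_lt v h1]
    · rw [wedgeMonomial_insert_of_lt v ha, ← mul_assoc, ι_mul_ι_swap, neg_mul, mul_assoc,
        ih hj.2, Finset.insert_comm, wedgeMonomial_insert_of_lt v (a := a) (U := insert j s),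
        Finset.filter_insert, if_pos h, Finset.card_insert_of_notMem (by simp [has]),
        pow_succ, ← mul_assoc, ← mul_assoc]
      · simp only [mul_neg, mul_one, neg_mul]
        congr 2
        exact ((Commute.neg_one_left _).pow_left _).symm.eq
      · intro u hu
        obtain rfl | hu := Finset.mem_insert.1 hu
        · exact h
        · exact ha u hu

theorem linearIndependent_wedgeMonomial (b : Module.Basis I K M) :
    LinearIndependent K (wedgeMonomial K b) := by
  convert! b.ExteriorAlgebra.linearIndependent using 1
  funext U
  rw [ExteriorAlgebra.basis_apply_ofCard b rfl, ιMulti_family, ιMulti_apply, wedgeMonomial,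
    ← Finset.listMap_orderEmbOfFin_finRange U rfl, List.map_map, List.ofFn_eq_map]
  rfl

end Wedge

/-- The two endpoints of an edge. -/
def KEdge.endpoints {n : ℕ} (e : KEdge n) : Finset (Fin n) := {e.1.1, e.1.2}

theorem KEdge.card_endpoints {n : ℕ} (e : KEdge n) : e.endpoints.card = 2 :=
  Finset.card_pair e.2.ne

theorem KEdge.mem_endpoints {n : ℕ} {e : KEdge n} {v : Fin n} :
    v ∈ e.endpoints ↔ e.1.1 = v ∨ e.1.2 = v := by
  rw [endpoints, Finset.mem_insert, Finset.mem_singleton, eq_comm, @eq_comm _ v]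

theorem isPerfectMatchingOn_iff {n : ℕ} {U : Finset (Fin n)} {E : Finset (KEdge n)} :
    IsPerfectMatchingOn U E ↔
      (E : Set (KEdge n)).PairwiseDisjoint KEdge.endpoints ∧ E.biUnion KEdge.endpoints = U := by
  constructor
  · rintro ⟨h1, h2⟩
    have h3 : ∀ e ∈ E, ∀ v ∈ e.endpoints, v ∈ U := by
      intro e he v hv
      obtain rfl | rfl := KEdge.mem_endpoints.1 hv
      exacts [(h1 e he).1, (h1 e he).2]
    refine ⟨fun e he f hf hef => ?_, ?_⟩
    · rw [Function.onFun, Finset.disjoint_left]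
      intro v hve hvf
      exact hef ((h2 v (h3 e he v hve)).unique ⟨he, KEdge.mem_endpoints.1 hve⟩
        ⟨hf, KEdge.mem_endpoints.1 hvf⟩)
    · ext v
      rw [Finset.mem_biUnion]
      constructor
      · rintro ⟨e, he, hv⟩
        exact h3 e he v hv
      · intro hv
        obtain ⟨e, ⟨he, hev⟩, -⟩ := h2 v hv
        exact ⟨e, he, KEdge.mem_endpoints.2 hev⟩
  · rintro ⟨h1, rfl⟩
    refine ⟨fun e he => ⟨Finset.mem_biUnion.2 ⟨e, he, KEdge.mem_endpoints.2 (Or.inl rfl)⟩,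
      Finset.mem_biUnion.2 ⟨e, he, KEdge.mem_endpoints.2 (Or.inr rfl)⟩⟩, fun v hv => ?_⟩
    obtain ⟨e, he, hev⟩ := Finset.mem_biUnion.1 hv
    refine ⟨e, ⟨he, KEdge.mem_endpoints.1 hev⟩, fun f ⟨hf, hfv⟩ => ?_⟩
    by_contra hne
    exact Finset.disjoint_left.1 (h1 hf he hne) (KEdge.mem_endpoints.2 hfv) hev

theorem crossingNumber_insert {n : ℕ} (a : KEdge n) (s : Finset (KEdge n))
    (ha : ∀ f ∈ s, a.1.1 < f.1.1) :
    crossingNumber (insert a s) =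
      crossingNumber s + (s.filter fun f => f.1.1 < a.1.2 ∧ a.1.2 < f.1.2).card := by
  classical
  have h1 : ((insert a s ×ˢ insert a s).filter fun ef : KEdge n × KEdge n =>
      ef.1.1.1 < ef.2.1.1 ∧ ef.2.1.1 < ef.1.1.2 ∧ ef.1.1.2 < ef.2.1.2) =
      ((s ×ˢ s).filter fun ef : KEdge n × KEdge n =>
        ef.1.1.1 < ef.2.1.1 ∧ ef.2.1.1 < ef.1.1.2 ∧ ef.1.1.2 < ef.2.1.2) ∪
      (s.filter fun f => f.1.1 < a.1.2 ∧ a.1.2 < f.1.2).image fun f => (a, f) := by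
    ext ⟨e, f⟩
    simp only [Finset.mem_filter, Finset.mem_product, Finset.mem_insert, Finset.mem_union,
      Finset.mem_image, Prod.mk.injEq]
    constructor
    · rintro ⟨⟨rfl | he, rfl | hf⟩, h⟩
      · exact absurd h.1 (lt_irrefl _)
      · exact Or.inr ⟨f, ⟨hf, h.2⟩, rfl, rfl⟩
      · exact absurd h.1 (ha e he).asymm
      · exact Or.inl ⟨⟨he, hf⟩, h⟩
    · rintro (⟨⟨he, hf⟩, h⟩ | ⟨f, ⟨hf, h⟩, rfl, rfl⟩)
      · exact ⟨⟨Or.inr he, Or.inr hf⟩, h⟩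
      · exact ⟨⟨Or.inl rfl, Or.inr hf⟩, ha f hf, h⟩
  have h2 : Disjoint ((s ×ˢ s).filter fun ef : KEdge n × KEdge n =>
      ef.1.1.1 < ef.2.1.1 ∧ ef.2.1.1 < ef.1.1.2 ∧ ef.1.1.2 < ef.2.1.2)
      ((s.filter fun f => f.1.1 < a.1.2 ∧ a.1.2 < f.1.2).image fun f => (a, f)) := by
    rw [Finset.disjoint_left]
    intro ef hef hef'
    obtain ⟨f, -, rfl⟩ := Finset.mem_image.1 hef'
    exact (ha a (Finset.mem_product.1 (Finset.mem_filter.1 hef).1).1).false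
  have h3 := congrArg Finset.card h1
  rw [Finset.card_union_of_disjoint h2,
    Finset.card_image_of_injective _ (Prod.mk_right_injective a)] at h3
  unfold crossingNumber
  convert! h3

/-- Modulo 2 only the edges around `j` count. If an edge ending at `j` starts before all others,
these are the edges that cross it. -/
theorem card_filter_biUnion_endpoints {n : ℕ} (s : Finset (KEdge n))
    (hs : (s : Set (KEdge n)).PairwiseDisjoint KEdge.endpoints) (j : Fin n)
    (hj : j ∉ s.biUnion KEdge.endpoints) :
    ((s.biUnion KEdge.endpoints).filter (· < j)).card =
      2 * (s.filter fun f => f.1.2 < j).card +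
        (s.filter fun f => f.1.1 < j ∧ j < f.1.2).card := by
  rw [Finset.filter_biUnion, Finset.card_biUnion fun e he f hf hef =>
    (hs he hf hef).mono (Finset.filter_subset _ _) (Finset.filter_subset _ _),
    Finset.card_filter, Finset.card_filter, Finset.mul_sum, ← Finset.sum_add_distrib]
  refine Finset.sum_congr rfl fun f hf => ?_
  have h1 : f.1.2 ≠ j := fun h =>
    hj (Finset.mem_biUnion.2 ⟨f, hf, KEdge.mem_endpoints.2 (Or.inr h)⟩)
  have h2 := f.2
  rw [KEdge.endpoints, Finset.filter_insert, Finset.filter_singleton]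
  split_ifs with h3 h4 h5 h6 <;> first | (simp [h2.ne]; done) | (exfalso; grind)

section Pfaffian

variable {K M : Type*} [CommRing K] [AddCommGroup M] [Module K M] {n : ℕ}

/-- Induction on the edge with the smallest first endpoint: its first vector is already in front,
and moving the second into place costs the sign of its crossings. -/
theorem prod_centralWedge_of_pairwiseDisjoint (v : Fin n → M) (E : Finset (KEdge n))
    (hE : (E : Set (KEdge n)).PairwiseDisjoint KEdge.endpoints) :
    (∏ f ∈ E, centralWedge (v f.1.1) (v f.1.2) :
      Subalgebra.center K (ExteriorAlgebra K M)).1 =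
        (-1) ^ crossingNumber E * wedgeMonomial K v (E.biUnion KEdge.endpoints) := by
  induction E using Finset.induction_on_min_value (fun e : KEdge n => e.1.1) with
  | empty => simp [crossingNumber, wedgeMonomial]
  | insert a s has hmin ih =>
    rw [Finset.coe_insert] at hE
    have hs := hE.subset (Set.subset_insert _ _)
    have hd : ∀ f ∈ s, Disjoint a.endpoints f.endpoints := fun f hf =>
      hE (Set.mem_insert _ _) (Set.mem_insert_of_mem _ hf) (by rintro rfl; exact has hf)
    have hlt : ∀ f ∈ s, a.1.1 < f.1.1 := fun f hf => (hmin f hf).lt_of_ne fun h =>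
      Finset.disjoint_left.1 (hd f hf) (KEdge.mem_endpoints.2 (Or.inl rfl))
        (KEdge.mem_endpoints.2 (Or.inl h.symm))
    have hj : a.1.2 ∉ s.biUnion KEdge.endpoints := by
      rw [Finset.mem_biUnion]
      rintro ⟨f, hf, hv⟩
      exact Finset.disjoint_left.1 (hd f hf) (KEdge.mem_endpoints.2 (Or.inr rfl)) hv
    have hi : ∀ u ∈ insert a.1.2 (s.biUnion KEdge.endpoints), a.1.1 < u := by
      intro u hu
      obtain rfl | hu := Finset.mem_insert.1 hu
      · exact a.2
      · obtain ⟨f, hf, hu⟩ := Finset.mem_biUnion.1 hu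
        obtain rfl | rfl := KEdge.mem_endpoints.1 hu
        exacts [hlt f hf, (hlt f hf).trans f.2]
    have hU : (insert a s).biUnion KEdge.endpoints =
        insert a.1.1 (insert a.1.2 (s.biUnion KEdge.endpoints)) := by
      rw [Finset.biUnion_insert, KEdge.endpoints, Finset.insert_union, Finset.singleton_union]
    have hc (m : ℕ) (x y : ExteriorAlgebra K M) : x * ((-1) ^ m * y) = (-1) ^ m * (x * y) :=
      ((Commute.neg_one_right x).pow_right m).left_comm y
    rw [Finset.prod_insert has, MulMemClass.coe_mul, ih hs, coe_centralWedge, hU,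
      wedgeMonomial_insert_of_lt v hi, crossingNumber_insert a s hlt, hc, mul_assoc,
      ι_mul_wedgeMonomial v _ _ hj, card_filter_biUnion_endpoints s hs _ hj, hc, pow_add, pow_add,
      pow_mul, neg_one_sq, one_pow, one_mul, mul_assoc]

theorem prod_centralWedge_of_not_pairwiseDisjoint (v : Fin n → M) (E : Finset (KEdge n))
    (hE : ¬ (E : Set (KEdge n)).PairwiseDisjoint KEdge.endpoints) :
    (∏ f ∈ E, centralWedge (v f.1.1) (v f.1.2) :
      Subalgebra.center K (ExteriorAlgebra K M)) = 0 := by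
  classical
  simp only [Set.PairwiseDisjoint, Set.Pairwise, not_forall] at hE
  obtain ⟨e, he, f, hf, hef, h⟩ := hE
  rw [← Finset.mul_prod_erase _ _ (Finset.mem_coe.1 he), ← Finset.mul_prod_erase (E.erase e) _
    (Finset.mem_erase.2 ⟨hef.symm, Finset.mem_coe.1 hf⟩), ← mul_assoc,
    centralWedge_mul_of_mem, zero_mul]
  obtain ⟨w, hwe, hwf⟩ := Finset.not_disjoint_iff.1 h
  rw [KEdge.mem_endpoints] at hwe hwf
  grind

/-- The bivector with coordinates `x`. -/
noncomputable def bivector (v : Fin n → M) (x : KEdge n → K) :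
    Subalgebra.center K (ExteriorAlgebra K M) :=
  ∑ e, x e • centralWedge (v e.1.1) (v e.1.2)

/-- In the expansion only sets of m disjoint edges survive; grouped by their vertex set U they give
the Pfaffians. -/
theorem bivector_pow (v : Fin n → M) (x : KEdge n → K) (m : ℕ) :
    (bivector v x ^ m).1 = m.factorial • ∑ U ∈ Finset.univ.powersetCard (2 * m),
      MvPolynomial.eval x (pfaffianPoly K U) • wedgeMonomial K v U := by
  classical
  have hcard (E : Finset (KEdge n))
      (hE : (E : Set (KEdge n)).PairwiseDisjoint KEdge.endpoints) :
      (E.biUnion KEdge.endpoints).card = 2 * E.card := by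
    rw [Finset.card_biUnion fun e he f hf => hE he hf]
    simp [KEdge.card_endpoints, mul_comm]
  rw [bivector, sum_pow_eq_factorial_smul_sum_powersetCard _ _ (fun e _ => by
    rw [smul_mul_smul_comm, centralWedge_mul_of_mem (Or.inl rfl), smul_zero])]
  rw [← Nat.cast_smul_eq_nsmul K, ← Nat.cast_smul_eq_nsmul K, SetLike.val_smul]
  congr 1
  rw [AddSubmonoidClass.coe_finsetSum, ← Finset.sum_filter_add_sum_filter_not _
    (fun E : Finset (KEdge n) => (E : Set (KEdge n)).PairwiseDisjoint KEdge.endpoints)]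
  rw [Finset.sum_eq_zero (s := Finset.filter (fun E : Finset (KEdge n) =>
    ¬ (E : Set (KEdge n)).PairwiseDisjoint KEdge.endpoints) _), add_zero]
  · rw [← Finset.sum_fiberwise_of_maps_to (t := Finset.univ.powersetCard (2 * m))
      (g := fun E => E.biUnion KEdge.endpoints)]
    · refine Finset.sum_congr rfl fun U hU => ?_
      rw [Finset.mem_powersetCard_univ] at hU
      rw [pfaffianPoly, map_sum, Finset.sum_smul]
      have hset : Finset.filter (fun E => E.biUnion KEdge.endpoints = U)
          (Finset.filter (fun E : Finset (KEdge n) =>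
            (E : Set (KEdge n)).PairwiseDisjoint KEdge.endpoints)
            (Finset.univ.powersetCard m)) =
          Finset.univ.filter (IsPerfectMatchingOn U) := by
        ext E
        simp only [Finset.mem_filter, Finset.mem_powersetCard_univ, Finset.mem_univ, true_and,
          isPerfectMatchingOn_iff]
        constructor
        · rintro ⟨⟨-, h1⟩, h2⟩
          exact ⟨h1, h2⟩
        · rintro ⟨h1, h2⟩
          have := hcard E h1
          rw [h2, hU] at this
          exact ⟨⟨by omega, h1⟩, h2⟩
      refine Finset.sum_congr (by convert! hset) fun E hE => ?_
      obtain ⟨h1, h2⟩ := isPerfectMatchingOn_iff.1 (Finset.mem_filter.1 hE).2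
      rw [Finset.prod_smul, SetLike.val_smul, prod_centralWedge_of_pairwiseDisjoint v E h1, h2]
      simp only [map_mul, map_pow, map_neg, map_one, map_prod, MvPolynomial.eval_X]
      rw [mul_comm ((-1) ^ _) (∏ e ∈ E, x e), mul_smul]
      congr 1
      rw [Algebra.smul_def]
      simp
    · intro E hE
      obtain ⟨h1, h2⟩ := Finset.mem_filter.1 hE
      rw [Finset.mem_powersetCard_univ] at h1 ⊢
      rw [hcard E h2, h1]
  · intro E hE
    rw [Finset.prod_smul, prod_centralWedge_of_not_pairwiseDisjoint v E (Finset.mem_filter.1 hE).2,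
      smul_zero]
    rfl

end Pfaffian

theorem bivector_pow_eq_zero_iff {K M : Type*} [Field K] [CharZero K] [AddCommGroup M] [Module K M]
    {n : ℕ} (b : Module.Basis (Fin n) K M) (x : KEdge n → K) (m : ℕ) :
    bivector b x ^ m = 0 ↔
      ∀ U : Finset (Fin n), U.card = 2 * m → MvPolynomial.eval x (pfaffianPoly K U) = 0 := by
  rw [← Subtype.coe_inj, bivector_pow]
  constructor
  · intro h U hU
    rw [ZeroMemClass.coe_zero, ← Nat.cast_smul_eq_nsmul K,
      smul_eq_zero_iff_right (Nat.cast_ne_zero.2 m.factorial_ne_zero)] at h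
    exact linearIndependent_iff'.1 (linearIndependent_wedgeMonomial b) _ _ h U
      (Finset.mem_powersetCard_univ.2 hU)
  · intro h
    rw [Finset.sum_eq_zero, smul_zero]
    · rfl
    · intro U hU
      rw [h U (Finset.mem_powersetCard_univ.1 hU), zero_smul]

theorem bivector_injective {K M : Type*} [CommRing K] [AddCommGroup M] [Module K M]
    {n : ℕ} (b : Module.Basis (Fin n) K M) : Function.Injective (bivector (K := K) b) := by
  intro x y hxy
  have h1 (x : KEdge n → K) :
      (bivector b x).1 = ∑ e, x e • wedgeMonomial K b e.endpoints := by
    rw [bivector, AddSubmonoidClass.coe_finsetSum]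
    refine Finset.sum_congr rfl fun e _ => ?_
    have h2 := prod_centralWedge_of_pairwiseDisjoint (K := K) b {e} (by simp)
    rw [Finset.prod_singleton, Finset.singleton_biUnion] at h2
    rw [SetLike.val_smul, h2]
    simp [crossingNumber, Finset.filter_singleton]
  have h2 : Function.Injective (KEdge.endpoints : KEdge n → _) := by
    intro e f h
    have h3 := (KEdge.mem_endpoints (e := e) (v := f.1.1)).1
      (by rw [h]; exact KEdge.mem_endpoints.2 (Or.inl rfl))
    have h4 := (KEdge.mem_endpoints (e := e) (v := f.1.2)).1
      (by rw [h]; exact KEdge.mem_endpoints.2 (Or.inr rfl))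
    have h5 := e.2
    have h6 := f.2
    refine Subtype.ext (Prod.ext ?_ ?_) <;> grind
  have h3 := Fintype.linearIndependent_iff.1 ((linearIndependent_wedgeMonomial b).comp _ h2) (x - y)
    (by simp only [Function.comp_apply, Pi.sub_apply, sub_smul, Finset.sum_sub_distrib, ← h1, hxy,
          sub_self])
  funext e
  exact sub_eq_zero.1 (h3 e)

/-! ### Bivectors with vanishing power and the image of T -/

section PairParametrization

open ExteriorAlgebra

variable {K : Type*} [Field K]

/-- The product is the wedge of the 2r independent vectors u_0, v_0, u_1, v_1, …. -/
theorem prod_centralWedge_ne_zero {V : Type*} [AddCommGroup V] [Module K V] {r : ℕ}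
    {u v : Fin r → V} (h : LinearIndependent K (Sum.elim u v)) :
    (∏ l, centralWedge (u l) (v l) : Subalgebra.center K (ExteriorAlgebra K V)) ≠ 0 := by
  let c : Fin r × Fin 2 → Fin r ⊕ Fin r := fun p => if p.2 = 0 then Sum.inl p.1 else Sum.inr p.1
  have hc : Function.Injective c := by
    rintro ⟨i, a⟩ ⟨j, b⟩ hab
    fin_cases a <;> fin_cases b <;> simp_all [c]
  let g : Fin (r * 2) → V := Sum.elim u v ∘ c ∘ finProdFinEquiv.symm
  have hg : LinearIndependent K g :=
    h.comp _ (hc.comp finProdFinEquiv.symm.injective)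
  have h1 := (exteriorPower.ιMulti_family_linearIndependent_field (n := r * 2) hg).ne_zero
    (Set.powersetCard.ofCard (s := Finset.univ) (by simp))
  intro h0
  apply h1
  have h2 : ((∏ l, centralWedge (u l) (v l) : Subalgebra.center K (ExteriorAlgebra K V))).1 =
      ιMulti K (r * 2) g := by
    rw [← List.prod_ofFn, ← Subalgebra.coe_val, map_list_prod, List.map_ofFn, ιMulti_apply,
      List.ofFn_mul, List.prod_flatten, List.map_ofFn]
    congr 2
    funext l
    have h3 (a : Fin 2) (ha) : g ⟨l * 2 + a, ha⟩ = Sum.elim u v (c (l, a)) := by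
      have : (⟨l * 2 + a, ha⟩ : Fin (r * 2)) = finProdFinEquiv (l, a) := by
        ext
        simp [finProdFinEquiv, mul_comm, add_comm]
      simp only [g, Function.comp_apply, this, Equiv.symm_apply_apply]
    simp only [Function.comp_apply, h3, List.ofFn_succ, List.ofFn_zero, List.prod_cons,
      List.prod_nil, mul_one]
    rfl
  rw [h0] at h2
  refine Subtype.ext ?_
  rw [exteriorPower.ιMulti_family_apply_coe]
  refine Eq.trans ?_ h2.symm
  rw [ιMulti_family]
  congr 1
  funext i
  have := Finset.orderEmbOfFin_unique' (s := Finset.univ) (k := r * 2) (by simp)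
    (f := (OrderIso.refl (Fin (r * 2))).toOrderEmbedding) (by simp)
  exact congrArg g (congrArg (fun f : Fin (r * 2) ↪o Fin (r * 2) => f i) this).symm

theorem sum_centralWedge_pow_ne_zero [CharZero K] {V : Type*} [AddCommGroup V] [Module K V] {r : ℕ}
    {u v : Fin r → V} (h : LinearIndependent K (Sum.elim u v)) :
    (∑ l, centralWedge (u l) (v l) : Subalgebra.center K (ExteriorAlgebra K V)) ^ r ≠ 0 := by
  rw [sum_pow_eq_factorial_smul_sum_powersetCard _ _
    (fun l _ => centralWedge_mul_of_mem (Or.inl rfl))]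
  have h1 : Finset.powersetCard r (Finset.univ : Finset (Fin r)) = {Finset.univ} := by
    ext E
    rw [Finset.mem_powersetCard_univ, Finset.mem_singleton, ← Finset.card_eq_iff_eq_univ,
      Fintype.card_fin]
  rw [h1, Finset.sum_singleton, ← Nat.cast_smul_eq_nsmul K]
  exact smul_ne_zero (Nat.cast_ne_zero.2 r.factorial_ne_zero) (prod_centralWedge_ne_zero h)

theorem sum_centralWedge_pow_eq_zero {V : Type*} [AddCommGroup V] [Module K V] {k : ℕ}
    (u v : Fin k → V) :
    (∑ l, centralWedge (u l) (v l) : Subalgebra.center K (ExteriorAlgebra K V)) ^ (k + 1) = 0 := by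
  rw [sum_pow_eq_factorial_smul_sum_powersetCard _ _
    (fun l _ => centralWedge_mul_of_mem (Or.inl rfl)), Finset.powersetCard_eq_empty.2 (by simp),
    Finset.sum_empty, smul_zero]

/-- The relation is solved for u_{l₀}; the terms of u_{l₀} ∧ v_{l₀} are multiples of u_l ∧ v_{l₀}
and v_l ∧ v_{l₀}, and the other summands absorb them when u_l and v_l are shifted by multiples of
v_{l₀}. -/
theorem exists_sum_centralWedge_of_relation {V : Type*} [AddCommGroup V] [Module K V] {r : ℕ}
    (u v : Fin (r + 1) → V) (α β : Fin (r + 1) → K) (hrel : ∑ l, (α l • u l + β l • v l) = 0)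
    (l₀ : Fin (r + 1)) (hl : α l₀ ≠ 0) :
    ∃ u' v' : Fin r → V, (∑ l, centralWedge (u l) (v l) :
      Subalgebra.center K (ExteriorAlgebra K V)) = ∑ l, centralWedge (u' l) (v' l) := by
  let γ := -(α l₀)⁻¹
  refine ⟨fun l => u (l₀.succAbove l) - (γ * β (l₀.succAbove l)) • v l₀,
    fun l => v (l₀.succAbove l) + (γ * α (l₀.succAbove l)) • v l₀, ?_⟩
  rw [Fin.sum_univ_succAbove _ l₀] at hrel ⊢
  have hu : u l₀ = γ • (β l₀ • v l₀ +
      ∑ l, (α (l₀.succAbove l) • u (l₀.succAbove l) + β (l₀.succAbove l) • v (l₀.succAbove l))) := by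
    rw [add_assoc] at hrel
    have h1 := eq_neg_of_add_eq_zero_right hrel
    rw [h1, smul_neg, smul_smul]
    simp [γ, hl]
  have hself : (centralWedge (v l₀) (v l₀) : Subalgebra.center K (ExteriorAlgebra K V)) = 0 :=
    centralWedge_self _
  have hswap (x y : V) : (centralWedge x y : Subalgebra.center K (ExteriorAlgebra K V)) =
      -centralWedge y x := Subtype.ext (ι_mul_ι_swap x y)
  conv_lhs => rw [hu]
  simp only [map_smul, map_add, map_sum, map_sub, LinearMap.smul_apply, LinearMap.add_apply,
    LinearMap.sum_apply, LinearMap.sub_apply, hself, smul_zero, sub_zero, zero_add,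
    Finset.smul_sum, smul_add, smul_smul, ← Finset.sum_add_distrib]
  refine Finset.sum_congr rfl fun l _ => ?_
  rw [hswap (v l₀)]
  module

theorem exists_sum_centralWedge_of_not_linearIndependent {V : Type*} [AddCommGroup V] [Module K V]
    {r : ℕ} (u v : Fin (r + 1) → V) (h : ¬ LinearIndependent K (Sum.elim u v)) :
    ∃ u' v' : Fin r → V, (∑ l, centralWedge (u l) (v l) :
      Subalgebra.center K (ExteriorAlgebra K V)) = ∑ l, centralWedge (u' l) (v' l) := by
  rw [Fintype.not_linearIndependent_iff] at h
  obtain ⟨g, hg, i, hi⟩ := h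
  rw [Fintype.sum_sum_type, ← Finset.sum_add_distrib] at hg
  obtain l | l := i
  · exact exists_sum_centralWedge_of_relation u v (fun l => g (Sum.inl l)) (fun l => g (Sum.inr l))
      hg l hi
  -- Here the nonzero coefficient belongs to a v; u ∧ v = v ∧ (-u) exchanges the roles.
  · obtain ⟨u', v', h⟩ := exists_sum_centralWedge_of_relation v (-u) (fun l => g (Sum.inr l))
      (fun l => -g (Sum.inl l)) (by simpa [add_comm] using hg) l hi
    refine ⟨u', v', h ▸ Finset.sum_congr rfl fun l _ => Subtype.ext ?_⟩
    rw [coe_centralWedge, coe_centralWedge, ι_mul_ι_swap, Pi.neg_apply, map_neg, mul_neg]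

/-- If r > k, the 2r vectors are dependent, since otherwise the r-th power would be nonzero. A
dependence shortens the sum by one term. -/
theorem exists_sum_centralWedge_of_pow_eq_zero [CharZero K] {V : Type*} [AddCommGroup V]
    [Module K V] {k r : ℕ} (u v : Fin r → V) (h : (∑ l, centralWedge (u l) (v l) :
      Subalgebra.center K (ExteriorAlgebra K V)) ^ (k + 1) = 0) :
    ∃ u' v' : Fin k → V, (∑ l, centralWedge (u l) (v l) :
      Subalgebra.center K (ExteriorAlgebra K V)) = ∑ l, centralWedge (u' l) (v' l) := by
  induction r with
  | zero => exact ⟨0, 0, by simp⟩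
  | succ r ih =>
    by_cases hrk : r + 1 ≤ k
    · obtain ⟨d, rfl⟩ := Nat.exists_eq_add_of_le hrk
      refine ⟨Fin.append u 0, Fin.append v 0, ?_⟩
      rw [eq_comm, Fin.sum_univ_add]
      simp
    · have hli : ¬ LinearIndependent K (Sum.elim u v) := fun hli =>
        sum_centralWedge_pow_ne_zero hli (pow_eq_zero_of_le (by omega) h)
      obtain ⟨u', v', h'⟩ := exists_sum_centralWedge_of_not_linearIndependent u v hli
      rw [h'] at h ⊢
      exact ih u' v' h

theorem centralWedge_eq_bivector {n : ℕ} (a c : Fin n → K) :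
    (centralWedge a c : Subalgebra.center K (ExteriorAlgebra K (Fin n → K))) =
      bivector (Pi.basisFun K (Fin n)) fun e : KEdge n =>
        a e.1.1 * c e.1.2 - a e.1.2 * c e.1.1 := by
  let w : Fin n → Fin n → Subalgebra.center K (ExteriorAlgebra K (Fin n → K)) := fun i j =>
    centralWedge (Pi.basisFun K (Fin n) i) (Pi.basisFun K (Fin n) j)
  have hw (i) : w i i = 0 := centralWedge_self _
  have hswap (i j) : w i j = -w j i := Subtype.ext (ι_mul_ι_swap _ _)
  have h1 : centralWedge a c = ∑ i, ∑ j, (a i * c j) • w i j := by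
    conv_lhs => rw [← (Pi.basisFun K (Fin n)).sum_repr a, ← (Pi.basisFun K (Fin n)).sum_repr c]
    simp only [map_sum, map_smul, LinearMap.sum_apply, LinearMap.smul_apply, Pi.basisFun_repr,
      Finset.smul_sum, smul_smul, w]
    rw [Finset.sum_comm]
    simp only [mul_comm]
  have h2 : ∑ i, ∑ j, (a i * c j) • w i j =
      ∑ i, ∑ j, (if i < j then (a i * c j) • w i j else 0) +
        ∑ i, ∑ j, (if j < i then (a i * c j) • w i j else 0) := by
    simp only [← Finset.sum_add_distrib]
    refine Finset.sum_congr rfl fun i _ => Finset.sum_congr rfl fun j _ => ?_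
    obtain h | rfl | h := lt_trichotomy i j
    · simp [h, h.not_gt]
    · simp [hw]
    · simp [h, h.not_gt]
  rw [h1, h2, bivector, sum_kEdge, Finset.sum_comm (f := fun i j => ite (j < i) _ _)]
  simp only [← Finset.sum_add_distrib]
  refine Finset.sum_congr rfl fun i _ => Finset.sum_congr rfl fun j _ => ?_
  split_ifs
  · rw [hswap j i]
    module
  · simp

theorem bivector_pairParamMap {k n : ℕ} (x : PairIndex k n → K) :
    bivector (Pi.basisFun K (Fin n)) (pairParamMap K k n x) =
      ∑ l, centralWedge (fun i => x (Sum.inl (l, i))) (fun i => x (Sum.inr (l, i))) := by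
  simp only [centralWedge_eq_bivector]
  simp only [bivector, pairParamMap, pairParamPoly, map_sum, map_sub, map_mul,
    MvPolynomial.eval_X, Finset.sum_smul]
  rw [Finset.sum_comm]

theorem mem_range_pairParamMap_iff [CharZero K] {k n : ℕ} (x : KEdge n → K) :
    x ∈ Set.range (pairParamMap K k n) ↔
      ∀ U : Finset (Fin n), U.card = 2 * (k + 1) → MvPolynomial.eval x (pfaffianPoly K U) = 0 := by
  rw [← bivector_pow_eq_zero_iff (Pi.basisFun K (Fin n))]
  constructor
  · rintro ⟨y, rfl⟩
    rw [bivector_pairParamMap, sum_centralWedge_pow_eq_zero]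
  · intro h
    let φ := (Fintype.equivFin (KEdge n)).symm
    have h1 : bivector (Pi.basisFun K (Fin n)) x =
        ∑ l, centralWedge (x (φ l) • Pi.basisFun K (Fin n) (φ l).1.1)
          (Pi.basisFun K (Fin n) (φ l).1.2) := by
      rw [bivector, ← φ.sum_comp]
      simp only [map_smul, LinearMap.smul_apply]
    rw [h1] at h
    obtain ⟨u, v, h2⟩ := exists_sum_centralWedge_of_pow_eq_zero _ _ h
    refine ⟨Sum.elim (fun li => u li.1 li.2) (fun li => v li.1 li.2),
      bivector_injective (Pi.basisFun K (Fin n)) ?_⟩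
    rw [bivector_pairParamMap, h1, h2]
    rfl

theorem map_pfaffianPoly {R S : Type*} [CommRing R] [CommRing S] (φ : R →+* S) {n : ℕ}
    (U : Finset (Fin n)) : MvPolynomial.map φ (pfaffianPoly R U) = pfaffianPoly S U := by
  simp [pfaffianPoly]

/-- Points may be taken in an extension L of K, so that the algebraic closure is covered too. -/
theorem range_pairParamMap (K L : Type*) [Field K] [Field L] [CharZero L] [Algebra K L]
    (k n : ℕ) :
    Set.range (pairParamMap L k n) = MvPolynomial.zeroLocus L (pfaffianIdeal K k n) := by
  ext x
  rw [mem_range_pairParamMap_iff, pfaffianIdeal, MvPolynomial.zeroLocus_span]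
  simp only [← map_pfaffianPoly (algebraMap K L), MvPolynomial.eval_map,
    ← MvPolynomial.aeval_def]
  constructor
  · rintro h f ⟨U, hU, rfl⟩
    exact h U hU
  · intro h U hU
    exact h _ ⟨U, hU, rfl⟩

end PairParametrization

/-! ### The radical of the Pfaffian ideal and its algebraic matroid -/

/-- By the Nullstellensatz the radical consists of the f that vanish on the image of T over the
algebraic closure, that is, f ∘ T is 0 as a function and hence as a polynomial. -/
theorem radical_pfaffianIdeal (K : Type*) [Field K] [CharZero K] (k n : ℕ) :
    (pfaffianIdeal K k n).radical = RingHom.ker (MvPolynomial.aeval (pairParamPoly K k n)) := by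
  have := charZero_of_injective_algebraMap (algebraMap K (AlgebraicClosure K)).injective
  rw [← MvPolynomial.vanishingIdeal_zeroLocus_eq_radical (K := AlgebraicClosure K),
    ← range_pairParamMap]
  ext f
  rw [MvPolynomial.mem_vanishingIdeal_iff, Set.forall_mem_range, RingHom.mem_ker,
    ← map_eq_zero_iff (MvPolynomial.map (algebraMap K (AlgebraicClosure K)))
      (MvPolynomial.map_injective _ (algebraMap K _).injective), MvPolynomial.funext_iff]
  refine forall_congr' fun y => ?_
  have h1 : pairParamMap (AlgebraicClosure K) k n y =
      fun e => MvPolynomial.aeval y (pairParamPoly K k n e) := by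
    funext e
    rw [pairParamMap, ← map_pairParamPoly (algebraMap K _), MvPolynomial.eval_map,
      MvPolynomial.aeval_def]
  rw [MvPolynomial.eval_map, ← MvPolynomial.aeval_def, map_zero, h1,
    ← MvPolynomial.comp_aeval_apply]

theorem mem_radical_pfaffianIdeal_iff {K : Type*} [Field K] [CharZero K] {k n : ℕ}
    (f : MvPolynomial (KEdge n) K) :
    f ∈ (pfaffianIdeal K k n).radical ↔ MvPolynomial.aeval (pairParamPoly K k n) f = 0 := by
  rw [radical_pfaffianIdeal, RingHom.mem_ker]

theorem algebraicIndepOn_pairParamPoly_iff (K : Type*) [Field K] [CharZero K] {k n : ℕ}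
    (S : Set (KEdge n)) :
    AlgebraicIndepOn K (pairParamPoly K k n) S ↔
      ∀ f ∈ pfaffianIdeal K k n, f ∈ MvPolynomial.supported K S → f = 0 := by
  refine Iff.trans (algebraicIndependent_comp_subtype (x := pairParamPoly K k n) (s := S)) ?_
  simp only [← mem_radical_pfaffianIdeal_iff]
  constructor
  · intro h f hf hfS
    exact h f hfS (Ideal.le_radical hf)
  · intro h f hfS hf
    -- The ideal itself replaces its radical, since powers of f stay in K[S].
    obtain ⟨m, hm⟩ := Ideal.mem_radical_iff.1 hf
    exact eq_zero_of_pow_eq_zero (h _ hm (pow_mem hfS m))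

theorem isAlgebraicMatroidOf_pfaffianIdeal (K : Type*) [Field K] [CharZero K] (k n : ℕ) :
    IsAlgebraicMatroidOf (genericHyperconnectivityMatroid (2 * k) n) (pfaffianIdeal K k n) :=
  ⟨rfl, fun S => (genericHyperconnectivityMatroid_indep_iff_algebraicIndepOn K S).trans
    (algebraicIndepOn_pairParamPoly_iff K S)⟩

theorem mainTheorem12 (K : Type*) [Field K] [CharZero K] (k n : ℕ) :
    -- the generic hyperconnectivity matroid is attained on an open dense set of configurations
    (∃ U : Set (Fin n → Fin (2 * k) → ℝ), IsOpen U ∧ Dense U ∧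
      ∀ p ∈ U, hyperconnectivityMatroid p = genericHyperconnectivityMatroid (2 * k) n) ∧
    -- the variety of the Pfaffian ideal is parametrized by `k` pairs of vectors
    Set.range (pairParamMap K k n) = MvPolynomial.zeroLocus K (pfaffianIdeal K k n) ∧
    -- the Jacobian of the parametrization is a hyperconnectivity matrix
    (∀ x : PairIndex k n → K,
      (pairParamJacobian x).reindex (Equiv.refl _) (pairColumns k n) =
        hyperconnectivityMatrix (pairConfiguration x)) ∧
    -- the algebraic matroid is the generic hyperconnectivity matroid
    IsAlgebraicMatroidOf (genericHyperconnectivityMatroid (2 * k) n) (pfaffianIdeal K k n) ∧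
    -- `k`-triangulations are bases
    ∀ T : Set (KEdge n), IsMultitriangulation k T →
      (genericHyperconnectivityMatroid (2 * k) n).IsBase T :=
  ⟨exists_isOpen_dense_hyperconnectivityMatroid_eq (2 * k) n, range_pairParamMap K K k n,
    pairParamJacobian_reindex, isAlgebraicMatroidOf_pfaffianIdeal K k n,
    fun _ hT => hT.isBase⟩
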